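/- **Setting.** The edges of a loopless undirected multigraph with weights in $[0,1]$ arrive one by one. Let $m$ be the maximum over all vertices of the minimum number of unit-sized bins needed to pack the weights of the edges incident to that vertex, and let $t$ be the maximum number of neighbours of a vertex. An edge of weight $x$ has type $i$ if $1/(i+1)<x\le 1/i$, for $1\le i\le 11$, and type $12$ if $x\le 1/12$. The HARMONIC$_{12}$-based online coloring algorithm keeps at most one open color of each type between any two vertices. An arriving edge $e=(u,v)$ of type $i$ gets the current open color of type $i$ between $u$ and $v$, if there is one and if at both ends the edges of this color, together with $e$, have total weight at most $1$. Otherwise $e$ gets the least color in $\{1,2,3,\dots\}$ that no edge at $u$ and no edge at $v$ has received so far, and this color becomes the open color of type $i$ between $u$ and $v$ (the previous one is closed). Let $R$ be the asymptotic worst-case performance ratio of the bin packing algorithm HARMONIC$_{12}$, that is, the infimum of all real $r$ for which there is a constant $c$ such that HARMONIC$_{12}$ uses at most $r\cdot\mathrm{OPT}(L)+c$ bins on every list $L$ of items of size in $[0,1]$. **Theorem (tightness of the analysis).** 1. $1.6924<R<1.6927$, hence $3.3848<2R<3.3854$. 2. There is a constant $C$ such that for every integer $m\ge 1$ there are a positive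 integer $\varepsilon\le C\sqrt m$ and an edge-arrival sequence of the following form. The vertices are a hub $w$ and pairs $u_i,v_i$ for $1\le i\le \lfloor\sqrt m\rfloor$. First, for each $i$ in turn, edges between $u_i$ and $v_i$ arrive, with the same list of weights for all $i$; then, for each $i$ in turn, edges between $w$ and $u_i$ arrive. The parameter of this sequence is exactly $m$, the hub $w$ has exactly $\lfloor\sqrt m\rfloor=o(m)$ neighbours, every vertex has at most $\lfloor\sqrt m\rfloor+1$ neighbours, and the number of colors which the algorithm uses on it is at least $2Rm-\varepsilon$ and at most $2Rm+\varepsilon$. All these colors lie in the palette of the colors numbered at most $3.39m+24t$. 3. Consequently the factor in front of $m$ in the analysis cannot be improved: if $\alpha,\beta$ are real numbers such that on every arrival sequence (on a finite vertex set) the algorithm uses at most $\alpha m+\beta t$ colors, then $\alpha\ge 2R$. -/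

import Mathlib

open scoped Classical in
/-- The least number of unit-sized bins into which the items of the list `L` can be packed:
`f i` is the bin of the `i`-th item, and the bins are numbered `0, …, k - 1`. -/
noncomputable def minBins (L : List ℝ) : ℕ :=
  sInf {k : ℕ | ∃ f : Fin L.length → Fin k, ∀ j : Fin k,
    ∑ i ∈ Finset.univ.filter (fun i => f i = j), L.get i ≤ 1}

/-- The type of an item for HARMONIC with `M` types: type `i` for `1 / (i + 1) < x ≤ 1 / i` when
`i < M`, and type `M` for `x ≤ 1 / M`. -/
noncomputable def itemType (M : ℕ) (x : ℝ) : ℕ :=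
  if x ≤ 1 / (M : ℝ) then M else ⌊1 / x⌋₊

open scoped Classical in
/-- The number of new bins which HARMONIC with `M` types opens on a list of items. The argument
`level` records the level of the open bin of each type (`none`: no such bin was opened yet). -/
noncomputable def harmonicFrom (M : ℕ) : (ℕ → Option ℝ) → List ℝ → ℕ
  | _, [] => 0
  | level, x :: L =>
    match level (itemType M x) with
    | none => harmonicFrom M (Function.update level (itemType M x) (some x)) L + 1
    | some l =>
      if l + x ≤ 1 then
        harmonicFrom M (Function.update level (itemType M x) (some (l + x))) L
      else
        harmonicFrom M (Function.update level (itemType M x) (some x)) L + 1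

/-- The number of bins used by HARMONIC with `M` types on the list `L`. -/
noncomputable def harmonicBins (M : ℕ) (L : List ℝ) : ℕ :=
  harmonicFrom M (fun _ => none) L

/-- All weights lie in `[0, 1]`. -/
def UnitWeights (L : List ℝ) : Prop := ∀ x ∈ L, 0 ≤ x ∧ x ≤ 1

/-- The asymptotic worst-case performance ratio of HARMONIC with `M` types as a bin packing
algorithm. -/
noncomputable def harmonicRatio (M : ℕ) : ℝ :=
  sInf {r : ℝ | ∃ c : ℝ, ∀ L : List ℝ, UnitWeights L →
    (harmonicBins M L : ℝ) ≤ r * minBins L + c}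

/-- A weighted undirected edge on the vertex set `V`. -/
structure WEdge (V : Type*) where
  ends : Sym2 V
  weight : ℝ

/-- An edge-arrival sequence (the list of its edges in the order of arrival) of a loopless
multigraph with weights in `[0, 1]`. -/
def ValidSequence {V : Type*} (σ : List (WEdge V)) : Prop :=
  ∀ e ∈ σ, ¬ e.ends.IsDiag ∧ 0 ≤ e.weight ∧ e.weight ≤ 1

open scoped Classical in
/-- The weights of the edges incident to `v`. -/
noncomputable def incidentWeights {V : Type*} (σ : List (WEdge V)) (v : V) : List ℝ :=
  (σ.filter (fun e => v ∈ e.ends)).map WEdge.weight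

/-- The parameter `m`: the maximum over the vertices of the least number of unit-sized bins needed
to pack the weights of the incident edges. -/
noncomputable def packingNumber {V : Type*} (σ : List (WEdge V)) : ℕ :=
  ⨆ v : V, minBins (incidentWeights σ v)

/-- The number of neighbours of `v`. -/
noncomputable def numNeighbours {V : Type*} (σ : List (WEdge V)) (v : V) : ℕ :=
  {x : V | x ≠ v ∧ ∃ e ∈ σ, e.ends = s(v, x)}.ncard

/-- The parameter `t`: the maximum number of neighbours of a vertex. -/
noncomputable def maxNeighbours {V : Type*} (σ : List (WEdge V)) : ℕ :=
  ⨆ v : V, numNeighbours σ v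

/-- A state of the online coloring algorithm: the open color of each type between each pair of
vertices (if there is one), and the edges that have arrived, with their colors. -/
structure ColoringState (V : Type*) where
  openColor : Sym2 V → ℕ → Option ℕ
  colored : List (WEdge V × ℕ)

open scoped Classical in
/-- The total weight of the edges at `v` that have color `c`. -/
noncomputable def ColoringState.load {V : Type*} (S : ColoringState V) (v : V) (c : ℕ) : ℝ :=
  ((S.colored.filter (fun p => v ∈ p.1.ends ∧ p.2 = c)).map (fun p => p.1.weight)).sum

/-- The edge `e` can be given the color `c` without violating the properness of the coloring. -/
def ColoringState.CanColor {V : Type*} (S : ColoringState V) (e : WEdge V) (c : ℕ) : Prop :=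
  ∀ v ∈ e.ends, S.load v c + e.weight ≤ 1

/-- The color `c` is empty for `v`: it is neither an open nor a closed color of `v`. As every color
is given to an edge when it is opened, this says that no edge at `v` has received it. -/
def ColoringState.IsEmptyAt {V : Type*} (S : ColoringState V) (v : V) (c : ℕ) : Prop :=
  ∀ p ∈ S.colored, v ∈ p.1.ends → p.2 ≠ c

/-- The least color (the colors are numbered `1, 2, 3, …`) which is empty for both ends of `e`. -/
noncomputable def ColoringState.newColor {V : Type*} (S : ColoringState V) (e : WEdge V) : ℕ :=
  sInf {c : ℕ | 1 ≤ c ∧ ∀ v ∈ e.ends, S.IsEmptyAt v c}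

open scoped Classical in
/-- The color given to the arriving edge `e`: the open color of its type between its ends if there
is one and `e` can be colored with it, otherwise a new color. -/
noncomputable def ColoringState.chooseColor {V : Type*} (M : ℕ) (S : ColoringState V)
    (e : WEdge V) : ℕ :=
  match S.openColor e.ends (itemType M e.weight) with
  | none => S.newColor e
  | some c => if S.CanColor e c then c else S.newColor e

open scoped Classical in
/-- One step of the algorithm: the arriving edge `e` is colored, and its color is from now on the
open color of its type between its ends (the previous one, if different, is closed). -/
noncomputable def ColoringState.step {V : Type*} (M : ℕ) (S : ColoringState V) (e : WEdge V) :
    ColoringState V where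
  openColor := Function.update S.openColor e.ends
    (Function.update (S.openColor e.ends) (itemType M e.weight) (some (S.chooseColor M e)))
  colored := (e, S.chooseColor M e) :: S.colored

/-- The final state of the online coloring algorithm based on HARMONIC with `M` types. -/
noncomputable def harmonicColoring {V : Type*} (M : ℕ) (σ : List (WEdge V)) : ColoringState V :=
  σ.foldl (ColoringState.step M) ⟨fun _ _ => none, []⟩

open scoped Classical in
/-- The set of colors used by the algorithm on the arrival sequence `σ`. -/
noncomputable def usedColors {V : Type*} (M : ℕ) (σ : List (WEdge V)) : Finset ℕ :=
  ((harmonicColoring M σ).colored.map Prod.snd).toFinset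

/-- The vertices: a hub `w` and `n` pairs `u i`, `v i`. -/
inductive HubVertex (n : ℕ) : Type
  | w : HubVertex n
  | u (i : Fin n) : HubVertex n
  | v (i : Fin n) : HubVertex n

/-- The arrival sequence in which first, for each `i` in turn, edges with weights `A` arrive between
`u i` and `v i`, and then, for each `i` in turn, edges with weights `B i` between `w` and `u i`. -/
def hubSequence {n : ℕ} (A : List ℝ) (B : Fin n → List ℝ) : List (WEdge (HubVertex n)) :=
  ((List.finRange n).flatMap fun i => A.map fun x => ⟨s(HubVertex.u i, HubVertex.v i), x⟩) ++
  ((List.finRange n).flatMap fun i => (B i).map fun x => ⟨s(HubVertex.w, HubVertex.u i), x⟩)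

/-! Between two vertices `x`, `y` without open colors, if the colors already present at `x` or `y`
form an initial segment {1, …, n}, then the coloring algorithm fed with a list L of weights runs
HARMONIC on L: open colors are open bins, loads are levels, and the new colors are n + 1, n + 2, …
(`extendsColoring_run`). On a hub sequence every pair therefore uses the same colors 1, …, H(A),
where H counts HARMONIC bins. Afterwards `u i` blocks exactly these colors and the hub blocks the
ones following them, so every bundle from the hub takes H(B) further colors. In total exactly H(A) +
n · H(B) colors are used. Let s = ⌊√m⌋. If A fits into m - s bins and B into s bins, then `u i`
needs at most m bins and the hub at most s² ≤ m. If H is close to R times the number of bins on both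
lists, the total is R(m - s) + s · R s = 2Rm - O(√m). Since B is used s times, its additive error
must be bounded independently of the number of bins. The upper estimate H(L) ≤ R · OPT(L) + 12 holds
because HARMONIC is superadditive up to 12 bins: many copies of a list exceeding it would refute
every admissible ratio close to R. The opposite estimate is the hard one: for each m there must be a
list with at most m bins on which H is at least Rm - 26 (`exists_list_harmonicRatio`). Here an
arbitrary bad list is rescaled to about m bins. The bins of its packing are points in a
4-dimensional space (share of the large items, number and total size of the type-12 items which open
HARMONIC bins, amount of remaining type-12 material, called sand). By Carathéodory, five bins carry
the average. About m bins in these proportions can be reassembled into a list, because the only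
constraint from Next Fit on type 12 is one linear inequality between these quantities, and sand may
be subdivided freely. All rounding errors are then constants. The numerical bounds come from a
weight function (above) and from two explicit bins (below). -/

/-! ### Packings as lists of multisets -/

/-- The items of `s` can be packed into `k` unit-sized bins. -/
def Packable (s : Multiset ℝ) (k : ℕ) : Prop :=
  ∃ P : List (Multiset ℝ), P.length ≤ k ∧ P.sum = s ∧ ∀ b ∈ P, b.sum ≤ 1

/-- `minBins` assigns indices to bins, whereas `Packable` sees only values. The passage is made one
item at a time: the head of the list is removed from any bin that contains an item of the same
value. -/
theorem exists_assignment (L : List ℝ) {k : ℕ} (P : Fin k → Multiset ℝ)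
    (hP : ∑ j, P j = (L : Multiset ℝ)) :
    ∃ f : Fin L.length → Fin k, ∀ j, ∑ i, (if f i = j then ({L.get i} : Multiset ℝ) else 0) = P j := by
  induction L generalizing P with
  | nil =>
    refine ⟨fun i => i.elim0, fun j => ?_⟩
    have h : ∑ j, P j = 0 := hP
    have := (Finset.sum_eq_zero_iff.mp h) j (Finset.mem_univ j)
    rw [this]; rfl
  | cons x L ih =>
    classical
    have hx : x ∈ ∑ j, P j := by rw [hP]; simp
    obtain ⟨j₀, -, hj₀⟩ := Multiset.mem_sum.mp hx
    obtain ⟨t, ht⟩ := Multiset.exists_cons_of_mem hj₀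
    have hupd : P = Function.update P j₀ t + Pi.single j₀ {x} := by
      funext j
      by_cases h : j = j₀
      · subst h; rw [ht, ← Multiset.singleton_add, add_comm]; simp
      · simp [h]
    have hsum : ∑ j, Function.update P j₀ t j = (L : Multiset ℝ) := by
      have h1 : ∑ j, P j = ∑ j, Function.update P j₀ t j + {x} := by
        conv_lhs => rw [hupd]
        simp [Finset.sum_add_distrib]
      rw [hP, ← Multiset.cons_coe, ← Multiset.singleton_add, add_comm] at h1
      exact (add_right_cancel h1).symm
    obtain ⟨f, hf⟩ := ih _ hsum
    refine ⟨Fin.cons j₀ f, fun j => ?_⟩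
    simp only [List.length_cons, Fin.sum_univ_succ, Fin.cons_zero, Fin.cons_succ]
    refine (congrArg (_ + ·) (hf j)).trans ?_
    conv_rhs => rw [hupd]
    by_cases h : j = j₀
    · subst h; simp [add_comm]
    · simp [h, Ne.symm h]

theorem Packable.mono {s : Multiset ℝ} {k l : ℕ} (h : Packable s k) (hkl : k ≤ l) :
    Packable s l := by
  obtain ⟨P, h1, h2⟩ := h
  exact ⟨P, h1.trans hkl, h2⟩

theorem Packable.exists_length_eq {s : Multiset ℝ} {k : ℕ} (h : Packable s k) :
    ∃ P : List (Multiset ℝ), P.length = k ∧ P.sum = s ∧ ∀ b ∈ P, b.sum ≤ 1 := by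
  obtain ⟨P, h1, h2, h3⟩ := h
  refine ⟨P ++ List.replicate (k - P.length) 0, by simp; omega, by simp [h2], fun b hb => ?_⟩
  rcases List.mem_append.mp hb with hb | hb
  · exact h3 b hb
  · rw [List.eq_of_mem_replicate hb]; simp

theorem packable_iff_exists_assignment (L : List ℝ) (k : ℕ) :
    Packable L k ↔ ∃ f : Fin L.length → Fin k, ∀ j : Fin k,
      ∑ i ∈ Finset.univ.filter (fun i => f i = j), L.get i ≤ 1 := by
  constructor
  · intro h
    obtain ⟨P, rfl, h2, h3⟩ := h.exists_length_eq
    obtain ⟨f, hf⟩ := exists_assignment L P.get (by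
      rw [← List.sum_ofFn, List.ofFn_get, h2])
    refine ⟨f, fun j => ?_⟩
    have h4 := h3 (P.get j) (List.get_mem _ _)
    rw [← hf j, Multiset.sum_sum] at h4
    rw [Finset.sum_filter]
    convert h4 using 2 with i
    split_ifs <;> simp
  · rintro ⟨f, hf⟩
    refine ⟨List.ofFn fun j => ∑ i ∈ Finset.univ.filter (fun i => f i = j), {L.get i}, by simp, ?_, ?_⟩
    · rw [List.sum_ofFn, Finset.sum_fiberwise]
      rw [← List.sum_ofFn]
      have : ∀ l : List ℝ, (l.map fun x => ({x} : Multiset ℝ)).sum = l := by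
        intro l
        induction l with
        | nil => rfl
        | cons a l ih => simp [ih]
      rw [← this L]
      congr 1
      conv_rhs => rw [← List.ofFn_get L, List.map_ofFn]
      rfl
    · intro b hb
      obtain ⟨j, rfl⟩ := (List.mem_ofFn' _ _).mp hb
      rw [Multiset.sum_sum]
      simpa using hf j

theorem minBins_eq_sInf (L : List ℝ) : minBins L = sInf {k : ℕ | Packable L k} := by
  unfold minBins
  congr 1
  ext k
  rw [Set.mem_ofPred_eq, Set.mem_ofPred_eq, packable_iff_exists_assignment]

theorem minBins_le_of_packable {L : List ℝ} {k : ℕ} (h : Packable L k) : minBins L ≤ k := by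
  rw [minBins_eq_sInf]
  exact Nat.sInf_le h

theorem packable_length {L : List ℝ} (hL : ∀ x ∈ L, x ≤ 1) : Packable L L.length := by
  refine ⟨L.map fun x => {x}, by simp, ?_, ?_⟩
  · induction L with
    | nil => rfl
    | cons a l ih =>
      simp only [List.map_cons, List.sum_cons]
      rw [ih fun x hx => hL x (by simp [hx])]; simp
  · intro b hb
    obtain ⟨x, hx, rfl⟩ := List.mem_map.mp hb
    simpa using hL x hx

theorem packable_minBins {L : List ℝ} (hL : ∀ x ∈ L, x ≤ 1) : Packable L (minBins L) := by
  rw [minBins_eq_sInf]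
  exact Nat.sInf_mem (s := {k : ℕ | Packable L k}) ⟨_, packable_length hL⟩

theorem Packable.add {s t : Multiset ℝ} {k l : ℕ} (hs : Packable s k) (ht : Packable t l) :
    Packable (s + t) (k + l) := by
  obtain ⟨P, h1, h2, h3⟩ := hs
  obtain ⟨Q, g1, g2, g3⟩ := ht
  refine ⟨P ++ Q, by simp; omega, by simp [h2, g2], fun b hb => ?_⟩
  rcases List.mem_append.mp hb with hb | hb
  exacts [h3 b hb, g3 b hb]

theorem packable_zero : Packable 0 0 := ⟨[], by simp⟩

theorem Packable.nsmul {s : Multiset ℝ} {k : ℕ} (hs : Packable s k) (n : ℕ) :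
    Packable (n • s) (n * k) := by
  induction n with
  | zero => simpa using packable_zero
  | succ n ih => rw [succ_nsmul, add_mul, one_mul]; exact ih.add hs

theorem Packable.sum_le {s : Multiset ℝ} {k : ℕ} (hs : Packable s k) : s.sum ≤ k := by
  obtain ⟨P, h1, rfl, h3⟩ := hs
  have : P.sum.sum ≤ P.length := by
    clear h1
    induction P with
    | nil => simp
    | cons b P ih =>
      have := ih fun b hb => h3 b (by simp [hb])
      have := h3 b (by simp)
      simp only [List.sum_cons, Multiset.sum_add, List.length_cons]
      push_cast
      linarith
  exact this.trans (by exact_mod_cast h1)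

theorem exists_add_eq_of_le_add {α : Type*} {b s t : Multiset α} (hb : b ≤ s + t) :
    ∃ b₁ b₂, b₁ + b₂ = b ∧ b₁ ≤ s ∧ b₂ ≤ t := by
  classical
  refine ⟨b ∩ s, b - b ∩ s, by
    rw [add_tsub_cancel_of_le Multiset.inter_le_left], Multiset.inter_le_right, ?_⟩
  rw [Multiset.le_iff_count] at hb ⊢
  intro a
  have := hb a
  simp only [Multiset.count_add, Multiset.count_sub, Multiset.count_inter] at this ⊢
  omega

/-- A decomposition of the sum of a list of multisets can be refined to the members of the list. -/
theorem exists_refinement {α : Type*} (P : List (Multiset α)) {s t : Multiset α}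
    (h : P.sum = s + t) :
    ∃ Q : List (Multiset α × Multiset α), Q.map (fun q => q.1 + q.2) = P ∧
      (Q.map Prod.fst).sum = s ∧ (Q.map Prod.snd).sum = t := by
  induction P generalizing s t with
  | nil =>
    have h' : s + t = 0 := h.symm
    rw [add_eq_zero] at h'
    exact ⟨[], by simp [h'.1, h'.2]⟩
  | cons b P ih =>
    rw [List.sum_cons] at h
    have hb : b ≤ s + t := h ▸ Multiset.le_add_right _ _
    obtain ⟨b₁, b₂, rfl, h1, h2⟩ := exists_add_eq_of_le_add hb
    obtain ⟨s', rfl⟩ := Multiset.le_iff_exists_add.mp h1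
    obtain ⟨t', rfl⟩ := Multiset.le_iff_exists_add.mp h2
    have : P.sum = s' + t' := by
      have h' : (b₁ + b₂) + P.sum = (b₁ + b₂) + (s' + t') := by rw [h]; abel
      exact add_left_cancel h'
    obtain ⟨Q, h3, h4, h5⟩ := ih this
    exact ⟨(b₁, b₂) :: Q, by simp [h3], by simp [h4], by simp [h5]⟩

theorem mem_le_list_sum {α : Type*} {P : List (Multiset α)} {b : Multiset α} (hb : b ∈ P) :
    b ≤ P.sum := by
  obtain ⟨P₁, P₂, rfl⟩ := List.append_of_mem hb
  simp only [List.sum_append, List.sum_cons]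
  exact (Multiset.le_add_right _ _).trans (Multiset.le_add_left _ _)

theorem Packable.of_le {s t : Multiset ℝ} {k : ℕ} (hs : Packable s k) (hts : t ≤ s)
    (h0 : ∀ x ∈ s, 0 ≤ x) : Packable t k := by
  obtain ⟨u, rfl⟩ := Multiset.le_iff_exists_add.mp hts
  obtain ⟨P, h1, h2, h3⟩ := hs
  obtain ⟨Q, rfl, g2, g3⟩ := exists_refinement P h2
  refine ⟨Q.map Prod.fst, by simpa using h1, g2, fun b hb => ?_⟩
  obtain ⟨q, hq, rfl⟩ := List.mem_map.mp hb
  have h4 := h3 _ (List.mem_map.mpr ⟨q, hq, rfl⟩)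
  have h5 : 0 ≤ q.2.sum := Multiset.sum_nonneg fun x hx => h0 x (by
    have : q.2 ≤ (Q.map Prod.snd).sum := mem_le_list_sum (List.mem_map.mpr ⟨q, hq, rfl⟩)
    rw [g3] at this
    exact Multiset.mem_add.mpr (Or.inr (Multiset.mem_of_le this hx)))
  rw [Multiset.sum_add] at h4
  linarith

/-! ### Next Fit, and superadditivity of HARMONIC -/

/-- The number of new bins opened by Next Fit on a list of items; the first argument is the level
of the open bin (`none`: there is no open bin). -/
noncomputable def nextFit : Option ℝ → List ℝ → ℕ
  | _, [] => 0
  | none, x :: L => nextFit (some x) L + 1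
  | some l, x :: L => if l + x ≤ 1 then nextFit (some (l + x)) L else nextFit (some x) L + 1

theorem nextFit_nil (o : Option ℝ) : nextFit o [] = 0 := by cases o <;> rfl

theorem nextFit_none_cons (x : ℝ) (L : List ℝ) :
    nextFit none (x :: L) = nextFit (some x) L + 1 := rfl

theorem nextFit_some_of_le {l x : ℝ} (L : List ℝ) (h : l + x ≤ 1) :
    nextFit (some l) (x :: L) = nextFit (some (l + x)) L := by
  simp [nextFit, h]

theorem nextFit_some_of_lt {l x : ℝ} (L : List ℝ) (h : 1 < l + x) :
    nextFit (some l) (x :: L) = nextFit (some x) L + 1 := by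
  simp [nextFit, not_le.mpr h]

theorem itemType_le {M : ℕ} (hM : 0 < M) (x : ℝ) : itemType M x ≤ M := by
  unfold itemType
  split_ifs with h
  · exact le_rfl
  · have hM' : (0 : ℝ) < M := by exact_mod_cast hM
    have hx : 0 < x := lt_trans (by positivity) (not_le.mp h)
    apply Nat.floor_le_of_le
    rw [div_le_iff₀ hx]
    have := not_le.mp h
    rw [div_lt_iff₀ hM'] at this
    linarith

/-- An item reads and changes only the level of its own type, so HARMONIC is an independent Next Fit
for each type. -/
theorem harmonicFrom_eq_sum {M : ℕ} (hM : 0 < M) (level : ℕ → Option ℝ) (L : List ℝ) :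
    harmonicFrom M level L =
      ∑ i ∈ Finset.range (M + 1), nextFit (level i) (L.filter fun x => itemType M x = i) := by
  induction L generalizing level with
  | nil => simp [harmonicFrom, nextFit_nil]
  | cons x L ih =>
    have hmem : itemType M x ∈ Finset.range (M + 1) :=
      Finset.mem_range.mpr (Nat.lt_succ_of_le (itemType_le hM x))
    have key : ∀ o : ℝ, (∑ i ∈ Finset.range (M + 1),
        nextFit (Function.update level (itemType M x) (some o) i)
          (L.filter fun x => itemType M x = i)) =
        nextFit (some o) (L.filter fun y => itemType M y = itemType M x) +
        ∑ i ∈ (Finset.range (M + 1)).erase (itemType M x),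
          nextFit (level i) ((x :: L).filter fun x => itemType M x = i) := by
      intro o
      rw [← Finset.add_sum_erase _ _ hmem]
      congr 1
      · simp
      · refine Finset.sum_congr rfl fun i hi => ?_
        have hne := Finset.ne_of_mem_erase hi
        rw [Function.update_of_ne hne, List.filter_cons_of_neg (by simpa using hne.symm)]
    rw [← Finset.add_sum_erase _ _ hmem, List.filter_cons_of_pos (by simp)]
    rw [harmonicFrom]
    cases hl : level (itemType M x) with
    | none =>
      simp only [nextFit_none_cons]
      rw [ih, key]
      ring
    | some l =>
      by_cases h : l + x ≤ 1
      · simp only [h, if_true, nextFit_some_of_le _ h]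
        rw [ih, key]
      · simp only [h, if_false, nextFit_some_of_lt _ (not_le.mp h)]
        rw [ih, key]
        ring

theorem harmonicBins_eq_sum {M : ℕ} (hM : 0 < M) (L : List ℝ) :
    harmonicBins M L =
      ∑ i ∈ Finset.range (M + 1), nextFit none (L.filter fun x => itemType M x = i) :=
  harmonicFrom_eq_sum hM _ L

/-- Compare two runs item by item. When only one of them overflows, it restarts at level `x` and is
one bin ahead; monotonicity and the bound by one extra bin then feed each other, hence the joint
induction. -/
theorem nextFit_some_mono_and_le_add_one (L : List ℝ) (hL : ∀ x ∈ L, 0 ≤ x) :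
    (∀ l l' : ℝ, l ≤ l' → nextFit (some l) L ≤ nextFit (some l') L) ∧
    (∀ l l' : ℝ, 0 ≤ l' → nextFit (some l) L ≤ nextFit (some l') L + 1) := by
  induction L with
  | nil => simp [nextFit_nil]
  | cons x L ih =>
    obtain ⟨ih1, ih2⟩ := ih fun y hy => hL y (by simp [hy])
    have hx := hL x (by simp)
    constructor
    · intro l l' hl
      by_cases h' : l' + x ≤ 1
      · rw [nextFit_some_of_le _ h', nextFit_some_of_le _ (by linarith)]
        exact ih1 _ _ (by linarith)
      · rw [nextFit_some_of_lt _ (not_le.mp h')]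
        by_cases h : l + x ≤ 1
        · rw [nextFit_some_of_le _ h]; exact ih2 _ _ hx
        · rw [nextFit_some_of_lt _ (not_le.mp h)]
    · intro l l' hl'
      by_cases h' : l' + x ≤ 1
      · rw [nextFit_some_of_le _ h']
        by_cases h : l + x ≤ 1
        · rw [nextFit_some_of_le _ h]; exact ih2 _ _ (by linarith)
        · rw [nextFit_some_of_lt _ (not_le.mp h)]
          exact Nat.add_le_add_right (ih1 _ _ (by linarith)) 1
      · rw [nextFit_some_of_lt _ (not_le.mp h')]
        by_cases h : l + x ≤ 1
        · rw [nextFit_some_of_le _ h]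
          exact (ih2 _ _ hx).trans (Nat.le_succ _)
        · rw [nextFit_some_of_lt _ (not_le.mp h)]
          exact Nat.le_succ _

theorem nextFit_none_le (l : ℝ) (L : List ℝ) (hl : 0 ≤ l) (hL : ∀ x ∈ L, 0 ≤ x) :
    nextFit none L ≤ nextFit (some l) L + 1 := by
  cases L with
  | nil => simp [nextFit_nil]
  | cons x L =>
    obtain ⟨h1, h2⟩ := nextFit_some_mono_and_le_add_one L fun y hy => hL y (by simp [hy])
    have hx := hL x (by simp)
    rw [nextFit_none_cons]
    by_cases h : l + x ≤ 1
    · rw [nextFit_some_of_le _ h]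
      exact Nat.add_le_add_right (h1 _ _ (by linarith)) 1
    · rw [nextFit_some_of_lt _ (not_le.mp h)]
      omega

theorem nextFit_some_append (l : ℝ) (L L' : List ℝ) (hl : 0 ≤ l) (hL : ∀ x ∈ L, 0 ≤ x)
    (hL' : ∀ x ∈ L', 0 ≤ x) :
    nextFit (some l) L + nextFit none L' ≤ nextFit (some l) (L ++ L') + 1 := by
  induction L generalizing l with
  | nil => simpa [nextFit_nil] using nextFit_none_le l L' hl hL'
  | cons x L ih =>
    have hx := hL x (by simp)
    have ih' := fun l hl => ih l hl fun y hy => hL y (by simp [hy])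
    rw [List.cons_append]
    by_cases h : l + x ≤ 1
    · rw [nextFit_some_of_le _ h, nextFit_some_of_le _ h]
      exact ih' _ (by linarith)
    · rw [nextFit_some_of_lt _ (not_le.mp h), nextFit_some_of_lt _ (not_le.mp h)]
      have := ih' x hx
      omega

theorem nextFit_none_append (L L' : List ℝ) (hL : ∀ x ∈ L, 0 ≤ x) (hL' : ∀ x ∈ L', 0 ≤ x) :
    nextFit none L + nextFit none L' ≤ nextFit none (L ++ L') + 1 := by
  cases L with
  | nil => simp [nextFit_nil]
  | cons x L =>
    rw [List.cons_append, nextFit_none_cons, nextFit_none_cons]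
    have := nextFit_some_append x L L' (hL x (by simp)) (fun y hy => hL y (by simp [hy])) hL'
    omega

theorem nextFit_le_append (o : Option ℝ) (L L' : List ℝ) : nextFit o L ≤ nextFit o (L ++ L') := by
  induction L generalizing o with
  | nil => simp [nextFit_nil]
  | cons x L ih =>
    rw [List.cons_append]
    cases o with
    | none => simpa [nextFit_none_cons] using ih _
    | some l =>
      by_cases h : l + x ≤ 1
      · rw [nextFit_some_of_le _ h, nextFit_some_of_le _ h]; exact ih _
      · rw [nextFit_some_of_lt _ (not_le.mp h), nextFit_some_of_lt _ (not_le.mp h)]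
        exact Nat.add_le_add_right (ih _) 1

theorem harmonicBins_le_append {M : ℕ} (hM : 0 < M) (L L' : List ℝ) :
    harmonicBins M L ≤ harmonicBins M (L ++ L') := by
  simp only [harmonicBins_eq_sum hM, List.filter_append]
  exact Finset.sum_le_sum fun i _ => nextFit_le_append _ _ _

theorem itemType_pos {M : ℕ} (hM : 0 < M) {x : ℝ} (hx : x ≤ 1) : 0 < itemType M x := by
  unfold itemType
  split_ifs with h
  · exact hM
  · have : 0 < x := lt_of_le_of_lt (by positivity) (not_le.mp h)
    exact Nat.floor_pos.mpr ((one_le_div this).mpr hx)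

theorem filter_itemType_zero {M : ℕ} (hM : 0 < M) {L : List ℝ} (hL : UnitWeights L) :
    L.filter (fun x => itemType M x = 0) = [] := by
  rw [List.filter_eq_nil_iff]
  intro x hx
  simpa using (itemType_pos hM (hL x hx).2).ne'

/-- One bin is lost per type at the junction of the lists. Type 0 does not occur for unit weights,
so the loss is `M` and not `M + 1`. -/
theorem harmonicBins_append {M : ℕ} (hM : 0 < M) (L L' : List ℝ) (hL : UnitWeights L)
    (hL' : UnitWeights L') :
    harmonicBins M L + harmonicBins M L' ≤ harmonicBins M (L ++ L') + M := by
  have h0 : ∀ K : List ℝ, UnitWeights K → harmonicBins M K =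
      ∑ i ∈ Finset.range M, nextFit none (K.filter fun x => itemType M x = i + 1) := by
    intro K hK
    rw [harmonicBins_eq_sum hM, Finset.sum_range_succ']
    rw [filter_itemType_zero hM hK, nextFit_nil, add_zero]
  have hLL : UnitWeights (L ++ L') := by
    intro x hx
    rcases List.mem_append.mp hx with hx | hx
    exacts [hL x hx, hL' x hx]
  rw [h0 _ hL, h0 _ hL', h0 _ hLL, ← Finset.sum_add_distrib]
  have hone : ∑ i ∈ Finset.range M, 1 = M := by simp
  refine le_trans ?_ (Finset.sum_add_distrib.trans (congrArg (_ + ·) hone)).le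
  refine Finset.sum_le_sum fun i _ => ?_
  rw [List.filter_append]
  exact nextFit_none_append _ _ (fun x hx => (hL x (List.mem_of_mem_filter hx)).1)
    (fun x hx => (hL' x (List.mem_of_mem_filter hx)).1)

theorem unitWeights_flatten_replicate {L : List ℝ} (hL : UnitWeights L) (n : ℕ) :
    UnitWeights (List.replicate n L).flatten := by
  intro x hx
  obtain ⟨K, hK, hx⟩ := List.mem_flatten.mp hx
  rw [List.eq_of_mem_replicate hK] at hx
  exact hL x hx

theorem coe_flatten_replicate (L : List ℝ) (n : ℕ) :
    ((List.replicate n L).flatten : Multiset ℝ) = n • (L : Multiset ℝ) := by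
  induction n with
  | zero => simp
  | succ n ih =>
    rw [List.replicate_succ, List.flatten_cons, ← Multiset.coe_add, ih, succ_nsmul, add_comm]

theorem harmonicBins_flatten_replicate {M : ℕ} (hM : 0 < M) {L : List ℝ} (hL : UnitWeights L)
    (n : ℕ) : n * harmonicBins M L ≤ harmonicBins M (List.replicate n L).flatten + n * M := by
  induction n with
  | zero => simp
  | succ n ih =>
    rw [List.replicate_succ, List.flatten_cons]
    have := harmonicBins_append hM L _ hL (unitWeights_flatten_replicate hL n)
    rw [add_mul, add_mul]
    omega

/-- Every admissible ratio is admissible with the additive constant `M`. -/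
theorem harmonicBins_le_of_admissible {M : ℕ} (hM : 0 < M) {r c : ℝ}
    (hr : ∀ L : List ℝ, UnitWeights L → (harmonicBins M L : ℝ) ≤ r * minBins L + c)
    (hr0 : 0 ≤ r) {L : List ℝ} (hL : UnitWeights L) :
    (harmonicBins M L : ℝ) ≤ r * minBins L + M := by
  by_contra! hcon
  set d := (harmonicBins M L : ℝ) - (r * minBins L + M) with hd
  have hd0 : 0 < d := by linarith
  -- An excess `d` over the claimed bound is multiplied by `n` when the list is repeated `n` times,
  -- and finally exceeds the constant `c`.
  obtain ⟨n, hn⟩ := exists_nat_gt (c / d)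
  rw [div_lt_iff₀ hd0] at hn
  have h1 := hr _ (unitWeights_flatten_replicate hL n)
  have h2 : (n * harmonicBins M L : ℝ) ≤ harmonicBins M (List.replicate n L).flatten + n * M := by
    exact_mod_cast harmonicBins_flatten_replicate hM hL n
  have h3 : (minBins (List.replicate n L).flatten : ℝ) ≤ n * minBins L := by
    have : minBins (List.replicate n L).flatten ≤ n * minBins L := by
      apply minBins_le_of_packable
      rw [coe_flatten_replicate]
      exact (packable_minBins fun x hx => (hL x hx).2).nsmul n
    exact_mod_cast this
  have h4 := mul_le_mul_of_nonneg_left h3 hr0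
  have h5 : n * d = n * harmonicBins M L - r * (n * minBins L) - n * M := by rw [hd]; ring
  linarith

/-! ### Item types and the number of bins per type -/

theorem itemType_of_le {M : ℕ} {x : ℝ} (h : x ≤ 1 / (M : ℝ)) : itemType M x = M := if_pos h

theorem itemType_eq_of_mem {M i : ℕ} (hi : 0 < i) (hiM : i < M) {x : ℝ}
    (h1 : 1 / ((i : ℝ) + 1) < x) (h2 : x ≤ 1 / (i : ℝ)) : itemType M x = i := by
  have hi' : (0 : ℝ) < i := by exact_mod_cast hi
  have hM : ((i : ℝ) + 1) ≤ M := by exact_mod_cast hiM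
  have hx : 0 < x := lt_trans (by positivity) h1
  have h3 : ¬ x ≤ 1 / (M : ℝ) := not_le.mpr
    (lt_of_le_of_lt (one_div_le_one_div_of_le (by positivity) hM) h1)
  rw [itemType, if_neg h3, Nat.floor_eq_iff (by positivity)]
  constructor
  · rw [le_div_iff₀ hx]; rw [le_div_iff₀ hi'] at h2; linarith
  · rw [div_lt_iff₀ hx]; rw [div_lt_iff₀ (by positivity)] at h1; linarith

theorem mem_of_itemType_eq {M i : ℕ} (hi : 0 < i) (hiM : i ≠ M) {x : ℝ} (h : itemType M x = i) :
    1 / ((i : ℝ) + 1) < x ∧ x ≤ 1 / (i : ℝ) := by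
  have hi' : (0 : ℝ) < i := by exact_mod_cast hi
  unfold itemType at h
  split_ifs at h with h1
  · exact absurd h.symm hiM
  · have hx : 0 < x := lt_of_le_of_lt (by positivity) (not_le.mp h1)
    rw [Nat.floor_eq_iff (by positivity)] at h
    obtain ⟨h2, h3⟩ := h
    rw [le_div_iff₀ hx] at h2
    rw [div_lt_iff₀ hx] at h3
    constructor
    · rw [div_lt_iff₀ (by positivity)]; linarith
    · rw [le_div_iff₀ hi']; linarith

theorem le_of_itemType_eq {M : ℕ} (hM : 0 < M) {x : ℝ} (h : itemType M x = M) :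
    x ≤ 1 / (M : ℝ) := by
  by_contra h1
  have hM' : (0 : ℝ) < M := by exact_mod_cast hM
  have hx : 0 < x := lt_of_le_of_lt (by positivity) (not_le.mp h1)
  rw [itemType, if_neg h1, Nat.floor_eq_iff (by positivity), le_div_iff₀ hx] at h
  exact h1 ((le_div_iff₀ hM').mpr (by linarith [h.1]))

/-- An open bin of level at most `j / i` is credited with `j` items. Items of size at most `1 / i`
overflow it only when the credit has reached `i`, so every closed bin is paid for by `i` items. -/
theorem nextFit_some_mul_le {i : ℕ} {L : List ℝ} (hL : ∀ x ∈ L, x ≤ 1 / (i : ℝ)) (hi : 0 < i)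
    {l : ℝ} {j : ℕ} (hj : j ≤ i) (hl : l ≤ j / (i : ℝ)) :
    nextFit (some l) L * i ≤ L.length + j := by
  have hi' : (0 : ℝ) < i := by exact_mod_cast hi
  induction L generalizing l j with
  | nil => simp [nextFit_nil]
  | cons x L ih =>
    have ih' := fun {l : ℝ} {j : ℕ} => ih (fun y hy => hL y (by simp [hy])) (l := l) (j := j)
    have hx := hL x (by simp)
    have hx1 := ih' hi (l := x) (j := 1) (by simpa using hx)
    rw [List.length_cons]
    by_cases h : l + x ≤ 1
    · rw [nextFit_some_of_le _ h]
      rcases hj.lt_or_eq with hj | rfl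
      · have := ih' hj (l := l + x) (by
          push_cast; rw [add_div]; linarith)
        omega
      · have := ih' le_rfl (l := l + x) (by rw [div_self hi'.ne']; exact h)
        omega
    · rw [nextFit_some_of_lt _ (not_le.mp h)]
      have : j = i := by
        refine le_antisymm hj ?_
        by_contra hlt
        apply h
        have h1 : (j : ℝ) + 1 ≤ i := by exact_mod_cast not_le.mp hlt
        have h2 : ((j : ℝ) + 1) / i ≤ 1 := (div_le_one hi').mpr h1
        rw [add_div] at h2
        linarith
      rw [add_mul]
      omega

theorem nextFit_none_mul_le {i : ℕ} {L : List ℝ} (hL : ∀ x ∈ L, x ≤ 1 / (i : ℝ)) (hi : 0 < i) :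
    nextFit none L * i ≤ L.length + i := by
  cases L with
  | nil => simp [nextFit_nil]
  | cons x L =>
    rw [nextFit_none_cons]
    have := nextFit_some_mul_le (fun y hy => hL y (by simp [hy])) hi (L := L) (l := x) (j := 1)
      hi (by simpa using hL x (by simp))
    rw [add_mul, List.length_cons]
    omega

/-- The converse count: items larger than `1 / (i + 1)` can never be more than `i` in one bin. -/
theorem le_mul_nextFit_some {i : ℕ} {L : List ℝ} (hL : ∀ x ∈ L, 1 / ((i : ℝ) + 1) < x)
    (hi : 0 < i) {l : ℝ} {j : ℕ} (hj : j ≤ i) (hl : j / ((i : ℝ) + 1) < l) :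
    L.length + j ≤ i * (nextFit (some l) L + 1) := by
  have hi' : (0 : ℝ) < i := by exact_mod_cast hi
  induction L generalizing l j with
  | nil => simpa [nextFit_nil] using hj
  | cons x L ih =>
    have ih' := fun {l : ℝ} {j : ℕ} => ih (fun y hy => hL y (by simp [hy])) (l := l) (j := j)
    have hx := hL x (by simp)
    rw [List.length_cons]
    by_cases h : l + x ≤ 1
    · rw [nextFit_some_of_le _ h]
      have h1 : ((j : ℝ) + 1) / (i + 1) < l + x := by rw [add_div]; linarith
      have h2 : ((j : ℝ) + 1) / (i + 1) < 1 := h1.trans_le h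
      rw [div_lt_one (by positivity)] at h2
      have h3 : j + 1 ≤ i := by exact_mod_cast (by linarith : (j : ℝ) < i)
      have := ih' h3 (l := l + x) (by push_cast; exact h1)
      omega
    · rw [nextFit_some_of_lt _ (not_le.mp h)]
      have := ih' hi (l := x) (j := 1) (by simpa using hx)
      rw [mul_add]
      omega

theorem le_mul_nextFit_none {i : ℕ} {L : List ℝ} (hL : ∀ x ∈ L, 1 / ((i : ℝ) + 1) < x)
    (hi : 0 < i) : L.length ≤ i * nextFit none L := by
  cases L with
  | nil => simp
  | cons x L =>
    exact le_mul_nextFit_some (fun y hy => hL y (by simp [hy])) hi (L := L) (l := x) (j := 1)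
      hi (by simpa using hL x (by simp))

/-- The fraction of a HARMONIC bin taken by an item that has not the last type. -/
noncomputable def binShare (M : ℕ) (x : ℝ) : ℝ :=
  if itemType M x = M then 0 else 1 / (itemType M x : ℝ)

theorem sum_map_eq_sum_filter {α : Type*} (f : α → ℝ) (t : α → ℕ) (n : ℕ) (L : List α)
    (h : ∀ x ∈ L, t x < n) :
    (L.map f).sum = ∑ i ∈ Finset.range n, ((L.filter fun x => t x = i).map f).sum := by
  induction L with
  | nil => simp
  | cons x L ih =>
    have hx := h x (by simp)
    have : ∀ i, (((x :: L).filter fun x => t x = i).map f).sum =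
        (if t x = i then f x else 0) + ((L.filter fun x => t x = i).map f).sum := by
      intro i
      by_cases hi : t x = i
      · simp [hi]
      · simp [hi]
    simp only [this, Finset.sum_add_distrib, List.map_cons, List.sum_cons]
    rw [ih fun y hy => h y (by simp [hy])]
    simp [hx]

theorem sum_binShare {M : ℕ} (hM : 0 < M) (L : List ℝ) :
    (L.map (binShare M)).sum =
      ∑ i ∈ Finset.range M, ((L.filter fun x => itemType M x = i).length : ℝ) / i := by
  rw [sum_map_eq_sum_filter _ (itemType M) (M + 1) L fun x _ =>
    Nat.lt_succ_of_le (itemType_le hM x), Finset.sum_range_succ]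
  have h0 : ((L.filter fun x => itemType M x = M).map (binShare M)).sum = 0 := by
    apply List.sum_eq_zero
    intro y hy
    obtain ⟨x, hx, rfl⟩ := List.mem_map.mp hy
    simp [binShare, (by simpa using (List.mem_filter.mp hx).2 : itemType M x = M)]
  rw [h0, add_zero]
  refine Finset.sum_congr rfl fun i hi => ?_
  have hi' := (Finset.mem_range.mp hi).ne
  rw [List.map_congr_left (g := fun _ => 1 / (i : ℝ))]
  · simp [div_eq_mul_inv]
  · intro x hx
    simp [binShare, (by simpa using (List.mem_filter.mp hx).2 : itemType M x = i), hi']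

theorem harmonicBins_le_binShare {M : ℕ} (hM : 0 < M) {L : List ℝ} (hL : UnitWeights L) :
    (harmonicBins M L : ℝ) ≤
      (L.map (binShare M)).sum + M + nextFit none (L.filter fun x => itemType M x = M) := by
  rw [harmonicBins_eq_sum hM, Finset.sum_range_succ, sum_binShare hM]
  push_cast
  refine add_le_add ?_ le_rfl
  have hone : ∑ i ∈ Finset.range M, (1 : ℝ) = M := by simp
  refine le_trans ?_ (Finset.sum_add_distrib.trans (congrArg (_ + ·) hone)).le
  refine Finset.sum_le_sum fun i hi => ?_
  rcases Nat.eq_zero_or_pos i with rfl | hi0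
  · rw [filter_itemType_zero hM hL]; simp [nextFit_nil]
  · have hi' : (0 : ℝ) < i := by exact_mod_cast hi0
    have := nextFit_none_mul_le (i := i) (L := L.filter fun x => itemType M x = i) (fun x hx =>
      (mem_of_itemType_eq hi0 (Finset.mem_range.mp hi).ne
        (by simpa using (List.mem_filter.mp hx).2)).2) hi0
    rw [div_add_one hi'.ne', le_div_iff₀ hi']
    exact_mod_cast this

theorem binShare_le_harmonicBins {M : ℕ} (hM : 0 < M) {L : List ℝ} :
    (L.map (binShare M)).sum + nextFit none (L.filter fun x => itemType M x = M) ≤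
      (harmonicBins M L : ℝ) := by
  rw [harmonicBins_eq_sum hM, Finset.sum_range_succ, sum_binShare hM]
  push_cast
  refine add_le_add ?_ le_rfl
  refine Finset.sum_le_sum fun i hi => ?_
  rcases Nat.eq_zero_or_pos i with rfl | hi0
  · simp
  · have hi' : (0 : ℝ) < i := by exact_mod_cast hi0
    have := le_mul_nextFit_none (i := i) (L := L.filter fun x => itemType M x = i) (fun x hx =>
      (mem_of_itemType_eq hi0 (Finset.mem_range.mp hi).ne
        (by simpa using (List.mem_filter.mp hx).2)).1) hi0
    rw [div_le_iff₀ hi', mul_comm]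
    exact_mod_cast this

/-- A bin is closed only at a level above `1 - 1/12 = 11/12`, so each new bin is paid for by 11/12
of size. -/
theorem nextFit_some_le_sum {L : List ℝ} (hL : ∀ x ∈ L, 0 ≤ x ∧ x ≤ 1 / 12) {l : ℝ} (hl : 0 ≤ l) :
    (nextFit (some l) L : ℝ) ≤ 12 / 11 * (l + L.sum) := by
  induction L generalizing l with
  | nil => simp [nextFit_nil]; linarith
  | cons x L ih =>
    have hx := hL x (by simp)
    have ih' := fun {l : ℝ} => ih (fun y hy => hL y (by simp [hy])) (l := l)
    rw [List.sum_cons]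
    by_cases h : l + x ≤ 1
    · rw [nextFit_some_of_le _ h]
      have := ih' (l := l + x) (by linarith)
      linarith
    · rw [nextFit_some_of_lt _ (not_le.mp h)]
      have := ih' (l := x) hx.1
      push_cast
      have := not_le.mp h
      linarith

theorem nextFit_none_le_sum {L : List ℝ} (hL : ∀ x ∈ L, 0 ≤ x ∧ x ≤ 1 / 12) :
    (nextFit none L : ℝ) ≤ 12 / 11 * L.sum + 1 := by
  cases L with
  | nil => simp [nextFit_nil]
  | cons x L =>
    have := nextFit_some_le_sum (fun y hy => hL y (by simp [hy])) (L := L) (hL x (by simp)).1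
    rw [nextFit_none_cons, List.sum_cons]
    push_cast
    linarith

/-! ### Upper bound for the ratio by a weight function -/

/-- The weights of the items in the analysis of HARMONIC with 12 types. -/
noncomputable def itemWeight (x : ℝ) : ℝ :=
  binShare 12 x + if itemType 12 x = 12 then 12 / 11 * x else 0

/-- An item of type `j < 12` is larger than `1 / (j + 1)` and weighs `1 / j`, so its density is
below `1 + 1 / j`, and `j ≥ k` here. For type 12 the density is `12 / 11 = 1 + 1 / 11`. -/
theorem itemWeight_le {k : ℕ} (hk : 0 < k) (hk' : k < 12) {x : ℝ} (hx : 0 ≤ x)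
    (hxk : x ≤ 1 / (k : ℝ)) : itemWeight x ≤ (1 + 1 / (k : ℝ)) * x := by
  have hk0 : (0 : ℝ) < k := by exact_mod_cast hk
  have hk1 : (k : ℝ) ≤ 11 := by exact_mod_cast Nat.le_of_lt_succ hk'
  by_cases h : itemType 12 x = 12
  · have : (1 : ℝ) / 11 ≤ 1 / (k : ℝ) := one_div_le_one_div_of_le hk0 hk1
    simp only [itemWeight, binShare, h, if_true, zero_add]
    exact mul_le_mul_of_nonneg_right (by linarith) hx
  · simp only [itemWeight, binShare, h, if_false, add_zero]
    have hx1 : x ≤ 1 := hxk.trans ((div_le_one hk0).mpr (by exact_mod_cast hk))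
    have hj := itemType_pos (M := 12) (by norm_num) hx1
    obtain ⟨h1, h2⟩ := mem_of_itemType_eq hj h rfl
    set j := itemType 12 x
    have hj0 : (0 : ℝ) < j := by exact_mod_cast hj
    have hkj : (k : ℝ) ≤ j := by
      have : 1 / ((j : ℝ) + 1) < 1 / k := h1.trans_le hxk
      rw [one_div_lt_one_div (by positivity) hk0] at this
      have : k < j + 1 := by exact_mod_cast this
      exact_mod_cast Nat.le_of_lt_succ this
    have h3 : 1 / (j : ℝ) ≤ 1 / k := one_div_le_one_div_of_le hk0 hkj
    calc 1 / (j : ℝ) = (1 + 1 / (j : ℝ)) * (1 / (j + 1)) := by field_simp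
      _ ≤ (1 + 1 / (j : ℝ)) * x := mul_le_mul_of_nonneg_left h1.le (by positivity)
      _ ≤ _ := mul_le_mul_of_nonneg_right (by linarith) hx

theorem itemWeight_eq {i : ℕ} (hi : 0 < i) (hi' : i < 12) {x : ℝ}
    (h1 : 1 / ((i : ℝ) + 1) < x) (h2 : x ≤ 1 / (i : ℝ)) : itemWeight x = 1 / i := by
  have h := itemType_eq_of_mem hi hi' h1 h2
  simp [itemWeight, binShare, h, hi'.ne]

theorem sum_itemWeight_le {s : Multiset ℝ} (h0 : ∀ x ∈ s, 0 ≤ x) {k : ℕ} (hk : 0 < k)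
    (hk' : k < 12) (h : ∀ x ∈ s, x ≤ 1 / (k : ℝ)) :
    (s.map itemWeight).sum ≤ (1 + 1 / (k : ℝ)) * s.sum := by
  have : (s.map fun x => (1 + 1 / (k : ℝ)) * x).sum = (1 + 1 / (k : ℝ)) * s.sum := by
    rw [Multiset.sum_map_mul_left, Multiset.map_id']
  rw [← this]
  exact Multiset.sum_map_le_sum_map _ _ fun x hx => itemWeight_le hk hk' (h0 x hx) (h x hx)

theorem le_sum_of_mem {s : Multiset ℝ} (h0 : ∀ x ∈ s, 0 ≤ x) {x : ℝ} (hx : x ∈ s) : x ≤ s.sum :=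
  Multiset.single_le_sum h0 x hx

theorem sum_itemWeight_small_le {s : Multiset ℝ} (h0 : ∀ x ∈ s, 0 ≤ x) (hs : s.sum ≤ 1 / 12) :
    (s.map itemWeight).sum ≤ 12 / 11 * s.sum := by
  have := sum_itemWeight_le h0 (k := 11) (by norm_num) (by norm_num)
    fun x hx => (le_sum_of_mem h0 hx).trans (hs.trans (by norm_num))
  norm_num at this ⊢
  exact this

/-- The extremal bin has items just above 1/2, 1/3 and 1/7, and the remaining 1/42 is filled at
density 12/11, which gives 2/77. If one of these items is missing, the density bound for the smaller
items already suffices: the totals are at most 3/2, 1 + 2/3 and 3/2 + 4/21. -/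
theorem sum_itemWeight_le_of_sum_le_one {s : Multiset ℝ} (h0 : ∀ x ∈ s, 0 ≤ x) (hs : s.sum ≤ 1) :
    (s.map itemWeight).sum ≤ 1 + 1 / 2 + 1 / 6 + 2 / 77 := by
  by_cases h1 : ∃ x ∈ s, 1 / 2 < x
  swap
  · push Not at h1
    have := sum_itemWeight_le h0 (k := 2) (by norm_num) (by norm_num) (by simpa using h1)
    push_cast at this
    linarith
  obtain ⟨x, hx, hx1⟩ := h1
  obtain ⟨s, rfl⟩ := Multiset.exists_cons_of_mem hx
  have h0' : ∀ y ∈ s, 0 ≤ y := fun y hy => h0 y (Multiset.mem_cons_of_mem hy)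
  have hw : itemWeight x = 1 := by
    have := le_sum_of_mem h0 hx
    have := itemWeight_eq (i := 1) (by norm_num) (by norm_num) (x := x)
      (by norm_num; linarith) (by norm_num; linarith)
    simpa using this
  rw [Multiset.map_cons, Multiset.sum_cons, hw]
  rw [Multiset.sum_cons] at hs
  clear h0 hx hw
  by_cases h2 : ∃ y ∈ s, 1 / 3 < y
  swap
  · push Not at h2
    have := sum_itemWeight_le h0' (k := 3) (by norm_num) (by norm_num) (by simpa using h2)
    push_cast at this
    linarith
  obtain ⟨y, hy, hy1⟩ := h2
  obtain ⟨s, rfl⟩ := Multiset.exists_cons_of_mem hy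
  have h0 : ∀ y ∈ s, 0 ≤ y := fun z hz => h0' z (Multiset.mem_cons_of_mem hz)
  have hw : itemWeight y = 1 / 2 := by
    have := le_sum_of_mem h0' hy
    have := itemWeight_eq (i := 2) (by norm_num) (by norm_num) (x := y)
      (by norm_num; linarith) (by norm_num; linarith)
    simpa using this
  rw [Multiset.map_cons, Multiset.sum_cons, hw]
  rw [Multiset.sum_cons] at hs
  clear h0' hy hw
  by_cases h3 : ∃ z ∈ s, 1 / 7 < z
  swap
  · push Not at h3
    have := sum_itemWeight_le h0 (k := 7) (by norm_num) (by norm_num) (by simpa using h3)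
    push_cast at this
    linarith
  obtain ⟨z, hz, hz1⟩ := h3
  obtain ⟨s, rfl⟩ := Multiset.exists_cons_of_mem hz
  have h0' : ∀ y ∈ s, 0 ≤ y := fun y hy => h0 y (Multiset.mem_cons_of_mem hy)
  have h4 := Multiset.sum_nonneg h0'
  rw [Multiset.sum_cons] at hs
  have hw : itemWeight z = 1 / 6 := by
    have := itemWeight_eq (i := 6) (by norm_num) (by norm_num) (x := z)
      (by norm_num; linarith) (by norm_num; linarith)
    simpa using this
  rw [Multiset.map_cons, Multiset.sum_cons, hw]
  have := sum_itemWeight_small_le h0' (by linarith)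
  linarith

theorem sum_map_le_of_packable {f : ℝ → ℝ} {ρ : ℝ} (hρ : 0 ≤ ρ)
    (hf : ∀ s : Multiset ℝ, (∀ x ∈ s, 0 ≤ x) → s.sum ≤ 1 → (s.map f).sum ≤ ρ)
    {s : Multiset ℝ} (h0 : ∀ x ∈ s, 0 ≤ x) {k : ℕ} (h : Packable s k) :
    (s.map f).sum ≤ ρ * k := by
  obtain ⟨P, h1, rfl, h3⟩ := h
  have : (P.sum.map f).sum ≤ ρ * P.length := by
    clear h1
    induction P with
    | nil => simp
    | cons b P ih =>
      rw [List.sum_cons] at h0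
      have h4 := ih (fun b hb => h3 b (by simp [hb]))
        fun x hx => h0 x (Multiset.mem_add.mpr (Or.inr hx))
      have h5 := hf b (fun x hx => h0 x (Multiset.mem_add.mpr (Or.inl hx))) (h3 b (by simp))
      simp only [List.sum_cons, Multiset.map_add, Multiset.sum_add, List.length_cons]
      push_cast
      linarith
  exact this.trans (mul_le_mul_of_nonneg_left (by exact_mod_cast h1) hρ)

/-- The constant is 12 for unfinished bins of the types, plus 1 for Next Fit on type 12. -/
theorem harmonicBins_twelve_le {L : List ℝ} (hL : UnitWeights L) :
    (harmonicBins 12 L : ℝ) ≤ (1 + 1 / 2 + 1 / 6 + 2 / 77) * minBins L + 13 := by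
  have h1 := harmonicBins_le_binShare (M := 12) (by norm_num) hL
  have h2 := nextFit_none_le_sum (L := L.filter fun x => itemType 12 x = 12) fun x hx => by
    refine ⟨(hL x (List.mem_of_mem_filter hx)).1, ?_⟩
    simpa using le_of_itemType_eq (M := 12) (by norm_num) (by simpa using (List.mem_filter.mp hx).2)
  have h3 := sum_map_le_of_packable (by norm_num)
    (fun s hs => sum_itemWeight_le_of_sum_le_one hs) (s := L)
    (fun x hx => (hL x (by simpa using hx)).1) (packable_minBins fun x hx => (hL x hx).2)
  have h4 : (((L : Multiset ℝ)).map itemWeight).sum = (L.map (binShare 12)).sum +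
      12 / 11 * (L.filter fun x => itemType 12 x = 12).sum := by
    rw [Multiset.map_coe, Multiset.sum_coe]
    clear h1 h2 h3 hL
    induction L with
    | nil => simp
    | cons x L ih =>
      rw [List.map_cons, List.sum_cons, ih]
      by_cases h : itemType 12 x = 12
      · simp [itemWeight, h]; ring
      · simp [itemWeight, h]; ring
  push_cast at h1
  linarith

/-! ### Openers and sand: rebuilding lists from bin patterns -/

/-- The items that open new bins can be separated from the other ones. -/
theorem exists_openers_of_some (L : List ℝ) (hL : ∀ x ∈ L, 0 ≤ x ∧ x ≤ 1) {l : ℝ} (hl0 : 0 ≤ l)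
    (hl : l ≤ 1) :
    ∃ O F : Multiset ℝ, O + F = L ∧ Multiset.card O = nextFit (some l) L ∧
      (Multiset.card O : ℝ) ≤ l + F.sum + 2 * O.sum ∧ ∀ x ∈ O, 0 < x := by
  induction L generalizing l with
  | nil => exact ⟨0, 0, by simp, by simp [nextFit_nil], by simpa, by simp⟩
  | cons x L ih =>
    have hx := hL x (by simp)
    have ih' := fun {l : ℝ} => ih (fun y hy => hL y (by simp [hy])) (l := l)
    by_cases h : l + x ≤ 1
    · obtain ⟨O, F, h1, h2, h3, h4⟩ := ih' (add_nonneg hl0 hx.1) h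
      refine ⟨O, x ::ₘ F, by simp [h1], by rw [h2, nextFit_some_of_le _ h], ?_, h4⟩
      rw [Multiset.sum_cons]
      linarith
    · obtain ⟨O, F, h1, h2, h3, h4⟩ := ih' hx.1 hx.2
      refine ⟨x ::ₘ O, F, by simp [h1],
        by rw [Multiset.card_cons, h2, nextFit_some_of_lt _ (not_le.mp h)], ?_, ?_⟩
      -- The overflow `1 < l + x` pays for the opener `x`. The same `x` is then the initial level of
      -- the next bin and helps to pay for the next opener; hence the factor 2 in front of `O.sum`.
      · have h5 := not_le.mp h
        rw [Multiset.card_cons, Multiset.sum_cons]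
        push_cast
        linarith
      · intro y hy
        rcases Multiset.mem_cons.mp hy with rfl | hy
        · linarith [not_le.mp h]
        · exact h4 y hy

theorem exists_openers (L : List ℝ) (hL : ∀ x ∈ L, 0 ≤ x ∧ x ≤ 1) :
    ∃ O F : Multiset ℝ, O + F = L ∧ nextFit none L ≤ Multiset.card O + 1 ∧
      (Multiset.card O : ℝ) ≤ F.sum + 2 * O.sum ∧ ∀ x ∈ O, 0 < x := by
  cases L with
  | nil => exact ⟨0, 0, by simp, by simp [nextFit_nil], by simp, by simp⟩
  | cons x L =>
    have hx := hL x (by simp)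
    obtain ⟨O, F, h1, h2, h3, h4⟩ := exists_openers_of_some L
      (fun y hy => hL y (by simp [hy])) hx.1 hx.2
    exact ⟨O, x ::ₘ F, by simp [h1], by rw [h2, nextFit_none_cons],
      by rw [Multiset.sum_cons]; exact h3, h4⟩

theorem nextFit_append_of_sum_le (L L' : List ℝ) (hL : ∀ x ∈ L, 0 ≤ x) {l : ℝ}
    (h : l + L.sum ≤ 1) : nextFit (some l) (L ++ L') = nextFit (some (l + L.sum)) L' := by
  induction L generalizing l with
  | nil => simp
  | cons x L ih =>
    have hL' : ∀ y ∈ L, 0 ≤ y := fun y hy => hL y (by simp [hy])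
    have h0 : 0 ≤ L.sum := List.sum_nonneg hL'
    rw [List.sum_cons] at h ⊢
    rw [List.cons_append, nextFit_some_of_le _ (by linarith), ih hL' (by linarith), add_assoc]

/-- The amounts of sand needed between consecutive openers. -/
def gaps (η : ℝ) : ℝ → List ℝ → List ℝ
  | _, [] => []
  | o, o' :: L => (1 - o - o' + η) :: gaps η o' L

/-- The openers, with the sand `g y` filling a gap of size `y`. -/
def fillGaps (g : ℝ → List ℝ) (η : ℝ) : ℝ → List ℝ → List ℝ
  | _, [] => []
  | o, o' :: L => g (1 - o - o' + η) ++ o' :: fillGaps g η o' L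

theorem coe_fillGaps (g : ℝ → List ℝ) (η o : ℝ) (L : List ℝ) :
    (fillGaps g η o L : Multiset ℝ) =
      L + ((gaps η o L).map fun y => (g y : Multiset ℝ)).sum := by
  induction L generalizing o with
  | nil => simp [fillGaps, gaps]
  | cons o' L ih =>
    rw [fillGaps, gaps, ← Multiset.coe_add, ← Multiset.cons_coe, ih, List.map_cons, List.sum_cons,
      ← Multiset.cons_coe, ← Multiset.singleton_add, ← Multiset.singleton_add]
    abel

/-- The sand after opener `o` raises the level to `1 - o' + η`. This is at most 1 because `η ≤ o'`,
and the next opener `o'` then overflows the bin by exactly `η`. -/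
theorem length_le_nextFit_fillGaps {g : ℝ → List ℝ} {η o : ℝ} {L : List ℝ} (hη : 0 < η)
    (ho : o ≤ 1 / 12) (hL : ∀ x ∈ L, η ≤ x ∧ x ≤ 1 / 12)
    (hg : ∀ y, 0 ≤ y → (∀ x ∈ g y, 0 ≤ x) ∧ (g y).sum = y) :
    L.length ≤ nextFit (some o) (fillGaps g η o L) := by
  induction L generalizing o with
  | nil => simp
  | cons o' L ih =>
    have ho' := hL o' (by simp)
    obtain ⟨h1, h2⟩ := hg (1 - o - o' + η) (by linarith)
    rw [fillGaps, nextFit_append_of_sum_le _ _ h1 (by rw [h2]; linarith), h2,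
      nextFit_some_of_lt _ (by linarith), List.length_cons]
    exact Nat.add_le_add_right (ih ho'.2 fun y hy => hL y (by simp [hy])) 1

/-- The sum telescopes: every opener of `L` bounds two gaps, except the last one, whose missing
second occurrence costs at most 1/12; `o` bounds only one. -/
theorem sum_gaps_le {η o : ℝ} {L : List ℝ} (ho : o ≤ 1 / 12) (hL : ∀ x ∈ L, x ≤ 1 / 12) :
    (gaps η o L).sum ≤ L.length * (1 + η) - 2 * L.sum - o + 1 / 12 := by
  induction L generalizing o with
  | nil => simp [gaps]; linarith
  | cons o' L ih =>
    have := ih (hL o' (by simp)) fun y hy => hL y (by simp [hy])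
    simp only [gaps, List.sum_cons, List.length_cons]
    push_cast
    linarith

theorem mem_gaps {η o : ℝ} {L : List ℝ} (hη : 0 < η) (ho0 : 0 ≤ o) (ho : o ≤ 1 / 12)
    (hL : ∀ x ∈ L, η ≤ x ∧ x ≤ 1 / 12) : ∀ y ∈ gaps η o L, 0 ≤ y ∧ y ≤ 1 := by
  induction L generalizing o with
  | nil => simp [gaps]
  | cons o' L ih =>
    have ho' := hL o' (by simp)
    intro y hy
    rcases List.mem_cons.mp hy with rfl | hy
    · constructor <;> linarith
    · exact ih (by linarith) ho'.2 (fun y hy => hL y (by simp [hy])) y hy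

/-- A bin of a packing: its items of types less than 12, the items of type 12 which open
a bin of HARMONIC, and the total size of the other items. -/
structure BinPattern where
  big : Multiset ℝ
  openers : Multiset ℝ
  sand : ℝ

/-- The contents of a pattern fit into a unit-sized bin. -/
structure BinPattern.Valid (d : BinPattern) : Prop where
  big_mem : ∀ x ∈ d.big, 1 / 12 < x ∧ x ≤ 1
  openers_mem : ∀ x ∈ d.openers, 0 < x ∧ x ≤ 1 / 12
  sand_nonneg : 0 ≤ d.sand
  sum_le : d.big.sum + d.openers.sum + d.sand ≤ 1

/-- The number of HARMONIC bins accounted for by the big items of a pattern. -/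
noncomputable def BinPattern.share (d : BinPattern) : ℝ := (d.big.map (binShare 12)).sum

theorem list_sum_map_comm {α β γ : Type*} [AddCommMonoid γ] (D : List α) (G : List β)
    (f : α → β → γ) :
    (D.map fun d => (G.map fun y => f d y).sum).sum =
      (G.map fun y => (D.map fun d => f d y).sum).sum := by
  induction D with
  | nil => simp
  | cons d D ih => simp [ih, List.sum_map_add]

theorem coe_flatMap {α β : Type*} (D : List α) (f : α → List β) :
    ((D.flatMap f : List β) : Multiset β) = (D.map fun d => (f d : Multiset β)).sum := by
  induction D with
  | nil => simp
  | cons d D ih => simp [← ih]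

theorem mem_list_sum {α : Type*} {P : List (Multiset α)} {x : α} :
    x ∈ P.sum ↔ ∃ b ∈ P, x ∈ b := by
  induction P with
  | nil => simp
  | cons b P ih => simp [ih]

theorem sum_list_sum (P : List (Multiset ℝ)) : P.sum.sum = (P.map Multiset.sum).sum := by
  induction P with
  | nil => simp
  | cons b P ih => simp [ih]

theorem exists_lower_bound (L : List ℝ) (hL : ∀ x ∈ L, 0 < x) (B : ℝ) (hB : 0 < B) :
    ∃ η, 0 < η ∧ η ≤ B ∧ ∀ x ∈ L, η ≤ x := by
  induction L with
  | nil => exact ⟨B, hB, le_rfl, by simp⟩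
  | cons x L ih =>
    obtain ⟨η, h1, h2, h3⟩ := ih fun y hy => hL y (by simp [hy])
    refine ⟨min η x, lt_min h1 (hL x (by simp)), (min_le_left _ _).trans h2, fun y hy => ?_⟩
    rcases List.mem_cons.mp hy with rfl | hy
    · exact min_le_right _ _
    · exact (min_le_left _ _).trans (h3 y hy)

theorem itemType_ne_of_lt {x : ℝ} (h : 1 / 12 < x) : itemType 12 x ≠ 12 := fun h' =>
  not_le.mpr h (by simpa using le_of_itemType_eq (M := 12) (by norm_num) h')

theorem itemType_twelve_of_le {x : ℝ} (h : x ≤ 1 / 12) : itemType 12 x = 12 :=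
  itemType_of_le (by simpa using h)

theorem share_add_nextFit_le {b : Multiset ℝ} (hb : ∀ x ∈ b, 1 / 12 < x) {S : List ℝ}
    (hS : ∀ x ∈ S, x ≤ 1 / 12) :
    (b.map (binShare 12)).sum + nextFit none S ≤ harmonicBins 12 (b.toList ++ S) := by
  refine le_trans ?_ (binShare_le_harmonicBins (M := 12) (by norm_num))
  have h1 : b.toList.filter (fun x => itemType 12 x = 12) = [] := by
    rw [List.filter_eq_nil_iff]
    intro x hx
    simpa using itemType_ne_of_lt (hb x (by simpa using hx))
  have h2 : S.filter (fun x => itemType 12 x = 12) = S := by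
    rw [List.filter_eq_self]
    intro x hx
    simpa using itemType_twelve_of_le (hS x hx)
  have h3 : (S.map (binShare 12)).sum = 0 := by
    apply List.sum_eq_zero
    intro y hy
    obtain ⟨x, hx, rfl⟩ := List.mem_map.mp hy
    exact if_pos (itemType_twelve_of_le (hS x hx))
  rw [List.filter_append, h1, h2, List.nil_append, List.map_append, List.sum_append, h3, add_zero,
    ← Multiset.sum_coe, ← Multiset.map_coe, Multiset.coe_toList]

theorem sum_map_share (D : List BinPattern) :
    (((D.map BinPattern.big).sum).map (binShare 12)).sum = (D.map BinPattern.share).sum := by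
  induction D with
  | nil => simp
  | cons d D ih => simp [ih, BinPattern.share]

/-- Converse of `exists_openers`: the linear inequality necessary for the items of `T` to open bins
is also sufficient, since the sand may be cut into arbitrarily small pieces and poured between
consecutive openers. Large items are placed first; their order is irrelevant. -/
theorem exists_list_of_patterns (D : List BinPattern) (hD : ∀ d ∈ D, d.Valid) (T : Multiset ℝ)
    (hT : T ≤ (D.map BinPattern.openers).sum)
    (hcard : (Multiset.card T : ℝ) ≤ (D.map BinPattern.sand).sum + 2 * T.sum) :
    ∃ L : List ℝ, UnitWeights L ∧ Packable L D.length ∧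
      (D.map BinPattern.share).sum + Multiset.card T ≤ harmonicBins 12 L := by
  set b := (D.map BinPattern.big).sum with hb
  set F := (D.map BinPattern.sand).sum with hF
  have hbig : ∀ x ∈ b, 1 / 12 < x ∧ x ≤ 1 := by
    intro x hx
    obtain ⟨c, hc, hx⟩ := mem_list_sum.mp hx
    obtain ⟨d, hd, rfl⟩ := List.mem_map.mp hc
    exact (hD d hd).big_mem x hx
  have hop : ∀ x ∈ (D.map BinPattern.openers).sum, 0 < x ∧ x ≤ 1 / 12 := by
    intro x hx
    obtain ⟨c, hc, hx⟩ := mem_list_sum.mp hx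
    obtain ⟨d, hd, rfl⟩ := List.mem_map.mp hc
    exact (hD d hd).openers_mem x hx
  have hTop : ∀ x ∈ T, 0 < x ∧ x ≤ 1 / 12 := fun x hx => hop x (Multiset.mem_of_le hT hx)
  -- `S` is the order of arrival of the type-12 items, and `f d` is the sand of `S` that the packing
  -- puts into the bin of pattern `d`.
  suffices h : ∃ (S : List ℝ) (f : BinPattern → Multiset ℝ),
      (S : Multiset ℝ) = T + (D.map f).sum ∧ (∀ x ∈ S, 0 ≤ x ∧ x ≤ 1 / 12) ∧
      (∀ d ∈ D, (f d).sum ≤ d.sand) ∧ Multiset.card T ≤ nextFit none S by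
    obtain ⟨S, f, h1, h2, h3, h4⟩ := h
    have hunit : UnitWeights (b.toList ++ S) := by
      intro x hx
      rcases List.mem_append.mp hx with hx | hx
      · have := hbig x (by simpa using hx)
        exact ⟨by linarith [this.1], this.2⟩
      · have := h2 x hx
        exact ⟨this.1, by linarith [this.2]⟩
    refine ⟨b.toList ++ S, hunit, ?_, ?_⟩
    · have hp : Packable (b + (D.map BinPattern.openers).sum + (D.map f).sum) D.length := by
        refine ⟨D.map fun d => d.big + d.openers + f d, by simp, ?_, ?_⟩
        · rw [hb, List.sum_map_add, List.sum_map_add]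
        · intro c hc
          obtain ⟨d, hd, rfl⟩ := List.mem_map.mp hc
          rw [Multiset.sum_add, Multiset.sum_add]
          linarith [(hD d hd).sum_le, h3 d hd]
      refine hp.of_le ?_ ?_
      · rw [← Multiset.coe_add, Multiset.coe_toList, h1, add_assoc]
        gcongr
      · intro x hx
        rw [Multiset.mem_add, Multiset.mem_add] at hx
        rcases hx with (hx | hx) | hx
        · linarith [(hbig x hx).1]
        · exact (hop x hx).1.le
        · refine (h2 x ?_).1
          rw [← Multiset.mem_coe, h1]
          exact Multiset.mem_add.mpr (Or.inr hx)
    · refine le_trans ?_ (share_add_nextFit_le (fun x hx => (hbig x hx).1) fun x hx => (h2 x hx).2)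
      rw [hb, sum_map_share]
      gcongr
  obtain ⟨l, rfl⟩ := Quot.exists_rep T
  change (∀ x ∈ (l : Multiset ℝ), _) at hTop
  change ((Multiset.card (l : Multiset ℝ) : ℕ) : ℝ) ≤ F + 2 * (l : Multiset ℝ).sum at hcard
  change ∃ (S : List ℝ) (f : BinPattern → Multiset ℝ), (S : Multiset ℝ) = (l : Multiset ℝ) + _ ∧ _ ∧
    _ ∧ Multiset.card (l : Multiset ℝ) ≤ _
  rw [Multiset.coe_card, Multiset.sum_coe] at hcard
  rw [Multiset.coe_card]
  cases l with
  | nil =>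
    exact ⟨[], fun _ => 0, by simp, by simp, fun d hd => by simpa using (hD d hd).sand_nonneg,
      by simp⟩
  | cons o L =>
    have ho := hTop o (by simp)
    have hL : ∀ x ∈ L, 0 < x ∧ x ≤ 1 / 12 := fun x hx => hTop x (by simp [hx])
    -- With this `η` all overflows together amount to less than 1/2. The first opener needs no
    -- preceding gap, so `hcard` leaves room for this.
    obtain ⟨η, hη, hηB, hηL⟩ := exists_lower_bound L (fun x hx => (hL x hx).1)
      (1 / (2 * (L.length + 1))) (by positivity)
    have hηL' : ∀ x ∈ L, η ≤ x ∧ x ≤ 1 / 12 := fun x hx => ⟨hηL x hx, (hL x hx).2⟩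
    have hG := mem_gaps hη ho.1.le ho.2 hηL'
    have hGsum : (gaps η o L).sum ≤ F := by
      have h1 := sum_gaps_le (η := η) ho.2 fun x hx => (hL x hx).2
      rw [le_div_iff₀ (by positivity)] at hηB
      simp only [List.length_cons, List.sum_cons] at hcard
      push_cast at hcard
      nlinarith [ho.2]
    have hLsum : L.sum ≤ L.length * (1 / 12) := by
      have := List.sum_le_card_nsmul L (1 / 12) fun x hx => (hL x hx).2
      rwa [nsmul_eq_mul] at this
    have hFpos : 0 < F := by
      simp only [List.length_cons, List.sum_cons] at hcard
      push_cast at hcard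
      have : (0 : ℝ) ≤ L.length := by positivity
      linarith [ho.2]
    have hdF : ∀ d ∈ D, d.sand ≤ F := fun d hd =>
      List.single_le_sum (l := D.map BinPattern.sand) (by
        intro x hx
        obtain ⟨d, hd, rfl⟩ := List.mem_map.mp hx
        exact (hD d hd).sand_nonneg) _ (List.mem_map_of_mem hd)
    -- A gap of size `y` draws on all patterns in proportion to their sand, so no pattern is
    -- overdrawn while the gaps sum to at most `F`. Cutting each portion into 12 pieces makes every
    -- piece at most 1/12, hence of type 12.
    let p : ℝ → BinPattern → List ℝ := fun y d => List.replicate 12 (y * d.sand / (12 * F))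
    let g : ℝ → List ℝ := fun y => D.flatMap (p y)
    have hp : ∀ y d, (p y d).sum = y * (d.sand / F) := by
      intro y d
      simp only [p, List.sum_replicate, nsmul_eq_mul]
      push_cast
      field_simp
    have hgmem : ∀ y, 0 ≤ y → ∀ x ∈ g y, 0 ≤ x := by
      intro y hy x hx
      obtain ⟨d, hd, hx⟩ := List.mem_flatMap.mp hx
      rw [List.eq_of_mem_replicate hx]
      have := (hD d hd).sand_nonneg
      positivity
    have hg : ∀ y, 0 ≤ y → (∀ x ∈ g y, 0 ≤ x) ∧ (g y).sum = y := by
      refine fun y hy => ⟨hgmem y hy, ?_⟩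
      rw [← Multiset.sum_coe, coe_flatMap, sum_list_sum, List.map_map]
      have : ((D.map fun d => y * (d.sand / F)).sum) = y := by
        rw [List.sum_map_mul_left]
        simp only [div_eq_mul_inv]
        rw [List.sum_map_mul_right, ← hF, mul_inv_cancel₀ hFpos.ne', mul_one]
      conv_rhs => rw [← this]
      congr 1
      refine List.map_congr_left fun d _ => ?_
      simp [hp]
    have hS : ((o :: fillGaps g η o L : List ℝ) : Multiset ℝ) = ((o :: L : List ℝ) : Multiset ℝ) +
        (D.map fun d => ((gaps η o L).map fun y => (p y d : Multiset ℝ)).sum).sum := by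
      rw [← Multiset.cons_coe, coe_fillGaps, ← Multiset.cons_coe, Multiset.cons_add,
        list_sum_map_comm]
      congr 4
      funext y
      exact coe_flatMap _ _
    refine ⟨o :: fillGaps g η o L, fun d => ((gaps η o L).map fun y => (p y d : Multiset ℝ)).sum,
      hS, ?_, ?_, ?_⟩
    · intro x hx
      rw [← Multiset.mem_coe, hS, Multiset.mem_add] at hx
      rcases hx with hx | hx
      · exact ⟨(hTop x hx).1.le, (hTop x hx).2⟩
      · obtain ⟨c, hc, hx⟩ := mem_list_sum.mp hx
        obtain ⟨d, hd, rfl⟩ := List.mem_map.mp hc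
        obtain ⟨c, hc, hx⟩ := mem_list_sum.mp hx
        obtain ⟨y, hy, rfl⟩ := List.mem_map.mp hc
        rw [Multiset.mem_coe] at hx
        rw [List.eq_of_mem_replicate hx]
        have h0 := (hD d hd).sand_nonneg
        have hy' := hG y hy
        refine ⟨div_nonneg (mul_nonneg hy'.1 h0) (by positivity), ?_⟩
        rw [div_le_iff₀ (by positivity)]
        nlinarith [hdF d hd, mul_le_mul_of_nonneg_right hy'.2 h0]
    · intro d hd
      rw [sum_list_sum, List.map_map]
      have : (gaps η o L).map (Multiset.sum ∘ fun y => (p y d : Multiset ℝ)) =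
          (gaps η o L).map fun y => y * (d.sand / F) :=
        List.map_congr_left fun y _ => by simp [hp]
      rw [this, List.sum_map_mul_right, List.map_id']
      calc (gaps η o L).sum * (d.sand / F) ≤ F * (d.sand / F) :=
            mul_le_mul_of_nonneg_right hGsum (div_nonneg (hD d hd).sand_nonneg hFpos.le)
        _ = d.sand := by field_simp
    · rw [nextFit_none_cons, List.length_cons]
      exact Nat.add_le_add_right (length_le_nextFit_fillGaps hη ho.2 hηL' hg) 1

theorem exists_card_eq_of_le {α : Type*} {s t : Multiset α} (h : s ≤ t) {n : ℕ}
    (hs : Multiset.card s ≤ n) (ht : n ≤ Multiset.card t) :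
    ∃ u, s ≤ u ∧ u ≤ t ∧ Multiset.card u = n := by
  obtain ⟨r, rfl⟩ := Multiset.le_iff_exists_add.mp h
  rw [Multiset.card_add] at ht
  refine ⟨s + (r.toList.take (n - Multiset.card s) : Multiset α), Multiset.le_add_right _ _, ?_, ?_⟩
  · gcongr
    conv_rhs => rw [← Multiset.coe_toList r]
    exact (List.take_sublist _ _).subperm
  · rw [Multiset.card_add, Multiset.coe_card, List.length_take, Multiset.length_toList]
    omega

theorem sum_map_flatMap_replicate {ι β γ : Type*} [Fintype ι] [AddCommMonoid γ] (d : ι → β)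
    (n : ι → ℕ) (f : β → γ) :
    (((Finset.univ : Finset ι).toList.flatMap fun i => List.replicate (n i) (d i)).map f).sum =
      ∑ i, n i • f (d i) := by
  rw [← Finset.sum_map_toList]
  induction (Finset.univ : Finset ι).toList with
  | nil => simp
  | cons i l ih => simp [ih]

theorem sum_le_sum_add_card {s t : Multiset ℝ} (h : s ≤ t) (ht : ∀ x ∈ t, x ≤ 1 / 12) :
    t.sum ≤ s.sum + (Multiset.card t - Multiset.card s) / 12 := by
  obtain ⟨r, rfl⟩ := Multiset.le_iff_exists_add.mp h
  have := Multiset.sum_le_card_nsmul r (1 / 12)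
    fun x hx => ht x (Multiset.mem_add.mpr (Or.inr hx))
  rw [nsmul_eq_mul] at this
  rw [Multiset.sum_add, Multiset.card_add]
  push_cast
  linarith

/-- Pattern `i` is taken about `m * θ i` times. Rounding perturbs the opener inequality by a
multiple of the number of patterns only, and this is repaired by not using a few openers. -/
theorem exists_list_of_combination {ι : Type*} [Fintype ι] (d : ι → BinPattern)
    (hd : ∀ i, (d i).Valid) (θ : ι → ℝ) (hθ : ∀ i, 0 ≤ θ i) (hθ1 : ∑ i, θ i = 1)
    (hk : ∑ i, θ i * Multiset.card (d i).openers ≤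
      ∑ i, θ i * (d i).sand + 2 * ∑ i, θ i * (d i).openers.sum) (m : ℕ) :
    ∃ L : List ℝ, UnitWeights L ∧ Packable L (m + Fintype.card ι) ∧
      m * (∑ i, θ i * (d i).share + ∑ i, θ i * Multiset.card (d i).openers) ≤
        harmonicBins 12 L + (3 * Fintype.card ι + 1) := by
  set q := Fintype.card ι with hq
  set n : ι → ℕ := fun i => ⌊m * θ i⌋₊ with hn
  have hmθ : ∀ i, 0 ≤ m * θ i := fun i => mul_nonneg (by positivity) (hθ i)
  have hn1 : ∀ i, (n i : ℝ) ≤ m * θ i := fun i => Nat.floor_le (hmθ i)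
  have hn2 : ∀ i, m * θ i ≤ n i + 1 := fun i => (Nat.lt_floor_add_one _).le
  have hshare : ∀ i, 0 ≤ (d i).share := fun i => Multiset.sum_nonneg fun y hy => by
    obtain ⟨x, -, rfl⟩ := Multiset.mem_map.mp hy
    unfold binShare
    split_ifs <;> positivity
  have hO0 : ∀ i, 0 ≤ (d i).openers.sum :=
    fun i => Multiset.sum_nonneg fun x hx => ((hd i).openers_mem x hx).1.le
  have hO1 : ∀ i, (d i).openers.sum ≤ 1 := fun i => by
    have h1 : 0 ≤ (d i).big.sum :=
      Multiset.sum_nonneg fun x hx => by linarith [((hd i).big_mem x hx).1]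
    linarith [(hd i).sum_le, (hd i).sand_nonneg]
  set D := (Finset.univ : Finset ι).toList.flatMap fun i => List.replicate (n i + 1) (d i) with hD
  have hDlen : D.length ≤ m + q := by
    have h1 : D.length = ∑ i, (n i + 1) := by
      have := sum_map_flatMap_replicate d (fun i => n i + 1) (fun _ => 1)
      simpa only [← hD, List.map_const', List.sum_replicate, smul_eq_mul, mul_one] using this
    have h2 : ((∑ i, n i : ℕ) : ℝ) ≤ m := by
      push_cast
      calc ∑ i, (n i : ℝ) ≤ ∑ i, m * θ i := Finset.sum_le_sum fun i _ => hn1 i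
        _ = m := by rw [← Finset.mul_sum, hθ1, mul_one]
    have h3 : ∑ i, n i ≤ m := by exact_mod_cast h2
    rw [h1, Finset.sum_add_distrib]
    simpa [hq] using h3
  have hDvalid : ∀ e ∈ D, e.Valid := by
    intro e he
    obtain ⟨i, -, he⟩ := List.mem_flatMap.mp he
    rw [List.eq_of_mem_replicate he]
    exact hd i
  have hDge : ∀ f : BinPattern → ℝ, (∀ i, 0 ≤ f (d i)) →
      m * ∑ i, θ i * f (d i) ≤ (D.map f).sum := by
    intro f hf
    rw [hD, sum_map_flatMap_replicate, Finset.mul_sum]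
    refine Finset.sum_le_sum fun i _ => ?_
    rw [nsmul_eq_mul, ← mul_assoc]
    push_cast
    exact mul_le_mul_of_nonneg_right (hn2 i) (hf i)
  set O₀ : Multiset ℝ := ∑ i, n i • (d i).openers with hO₀
  have hO₁ : (D.map BinPattern.openers).sum = ∑ i, (n i + 1) • (d i).openers :=
    sum_map_flatMap_replicate _ _ _
  have hO₀₁ : O₀ ≤ (D.map BinPattern.openers).sum := by
    rw [hO₁]
    refine Finset.sum_le_sum fun i _ => ?_
    rw [succ_nsmul]
    exact Multiset.le_add_right _ _
  set κ := ∑ i, θ i * (Multiset.card (d i).openers : ℝ) with hκ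
  have hκ0 : 0 ≤ m * κ := mul_nonneg (by positivity)
    (Finset.sum_nonneg fun i _ => mul_nonneg (hθ i) (by positivity))
  have hcard₀ : Multiset.card O₀ ≤ ⌊m * κ⌋₊ := by
    apply Nat.le_floor
    rw [hO₀, Multiset.card_sum]
    push_cast
    rw [hκ, Finset.mul_sum]
    refine Finset.sum_le_sum fun i _ => ?_
    rw [Multiset.card_nsmul, ← mul_assoc]
    push_cast
    exact mul_le_mul_of_nonneg_right (hn1 i) (by positivity)
  have hcard₁ : ⌊m * κ⌋₊ ≤ Multiset.card (D.map BinPattern.openers).sum := by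
    have : m * κ ≤ (Multiset.card (D.map BinPattern.openers).sum : ℕ) := by
      rw [hO₁, Multiset.card_sum]
      push_cast
      rw [hκ, Finset.mul_sum]
      refine Finset.sum_le_sum fun i _ => ?_
      rw [Multiset.card_nsmul, ← mul_assoc]
      push_cast
      exact mul_le_mul_of_nonneg_right (hn2 i) (by positivity)
    exact_mod_cast (Nat.floor_le hκ0).trans this
  -- `T₀` has the ideal number of openers, rounded down, and contains those of the `n i` full
  -- copies, so its total size is at most `q` below the ideal. Dropping `3 * q` openers loses at
  -- most `q / 4` more in size. As sizes count twice, the inequality worsens by at most `5 * q / 2`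
  -- in size and gains `3 * q` in number.
  obtain ⟨T₀, h₀, h₁, hT₀⟩ := exists_card_eq_of_le hO₀₁ hcard₀ hcard₁
  obtain ⟨T, -, hT, hTcard⟩ := exists_card_eq_of_le (Multiset.zero_le T₀)
    (n := Multiset.card T₀ - 3 * q) (by simp) (Nat.sub_le _ _)
  have hmemO : ∀ x ∈ (D.map BinPattern.openers).sum, 0 < x ∧ x ≤ 1 / 12 := by
    intro x hx
    obtain ⟨c, hc, hx⟩ := mem_list_sum.mp hx
    obtain ⟨e, he, rfl⟩ := List.mem_map.mp hc
    exact (hDvalid e he).openers_mem x hx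
  have hmemT₀ : ∀ x ∈ T₀, 0 < x ∧ x ≤ 1 / 12 := fun x hx => hmemO x (Multiset.mem_of_le h₁ hx)
  have hsand0 : 0 ≤ (D.map BinPattern.sand).sum := List.sum_nonneg fun x hx => by
    obtain ⟨e, he, rfl⟩ := List.mem_map.mp hx
    exact (hDvalid e he).sand_nonneg
  have hT0 : 0 ≤ T.sum :=
    Multiset.sum_nonneg fun x hx => (hmemT₀ x (Multiset.mem_of_le hT hx)).1.le
  have hcard : (Multiset.card T : ℝ) ≤ (D.map BinPattern.sand).sum + 2 * T.sum := by
    rcases le_total (Multiset.card T₀) (3 * q) with hc | hc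
    · rw [hTcard, Nat.sub_eq_zero_of_le hc]
      push_cast
      linarith
    · have h2 := sum_le_sum_add_card hT fun x hx => (hmemT₀ x hx).2
      have h3 : O₀.sum ≤ T₀.sum := by
        obtain ⟨r, rfl⟩ := Multiset.le_iff_exists_add.mp h₀
        rw [Multiset.sum_add]
        linarith [Multiset.sum_nonneg fun x hx =>
          (hmemT₀ x (Multiset.mem_add.mpr (Or.inr hx))).1.le]
      have h4 : m * ∑ i, θ i * (d i).openers.sum - q ≤ O₀.sum := by
        have : (q : ℝ) = ∑ i : ι, 1 := by simp [hq]
        rw [hO₀, Multiset.sum_sum, this, Finset.mul_sum, ← Finset.sum_sub_distrib]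
        refine Finset.sum_le_sum fun i _ => ?_
        rw [Multiset.sum_nsmul, nsmul_eq_mul]
        nlinarith [hn2 i, hO0 i, hO1 i]
      have h5 := hDge BinPattern.sand fun i => (hd i).sand_nonneg
      have h6 : (Multiset.card T₀ : ℝ) ≤ m * κ := by rw [hT₀]; exact Nat.floor_le hκ0
      have h7 := mul_le_mul_of_nonneg_left hk (Nat.cast_nonneg' (α := ℝ) m)
      have h8 : (Multiset.card T : ℝ) = Multiset.card T₀ - 3 * q := by
        rw [hTcard, Nat.cast_sub hc]; push_cast; ring
      have h9 : (0 : ℝ) ≤ q := by positivity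
      linarith
  obtain ⟨L, hL1, hL2, hL3⟩ := exists_list_of_patterns D hDvalid T (hT.trans h₁) hcard
  refine ⟨L, hL1, hL2.mono hDlen, ?_⟩
  have h2 := hDge BinPattern.share hshare
  have h3 : m * κ ≤ Multiset.card T + 3 * q + 1 := by
    have h4 : m * κ ≤ Multiset.card T₀ + 1 := by rw [hT₀]; exact (Nat.lt_floor_add_one _).le
    have h5 : Multiset.card T₀ ≤ Multiset.card T + 3 * q := by omega
    have : (Multiset.card T₀ : ℝ) ≤ Multiset.card T + 3 * q := by exact_mod_cast h5
    linarith
  linarith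

/-! ### Reduction of an arbitrary packing to five patterns -/

/-- The data of a pattern that matter for the count of HARMONIC bins. -/
noncomputable def BinPattern.data (d : BinPattern) : Fin 4 → ℝ :=
  ![d.share, Multiset.card d.openers, d.sand, d.openers.sum]

/-- Each bin splits into its large items, openers and remaining small items, the latter recorded
only by total size. All four data are additive over the bins. -/
theorem exists_patterns_of_packing (P : List (Multiset ℝ)) {s t u : Multiset ℝ}
    (h : P.sum = s + t + u) (hP : ∀ b ∈ P, b.sum ≤ 1) (hs : ∀ x ∈ s, 1 / 12 < x ∧ x ≤ 1)
    (ht : ∀ x ∈ t, 0 < x ∧ x ≤ 1 / 12) (hu : ∀ x ∈ u, 0 ≤ x) :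
    ∃ D : List BinPattern, D.length = P.length ∧ (∀ d ∈ D, d.Valid) ∧
      (D.map BinPattern.data).sum =
        ![(s.map (binShare 12)).sum, Multiset.card t, u.sum, t.sum] := by
  induction P generalizing s t u with
  | nil =>
    have h' : s + t + u = 0 := h.symm
    rw [add_eq_zero, add_eq_zero] at h'
    obtain ⟨⟨rfl, rfl⟩, rfl⟩ := h'
    refine ⟨[], rfl, by simp, ?_⟩
    funext i
    fin_cases i <;> simp
  | cons b P ih =>
    rw [List.sum_cons] at h
    have hb : b ≤ s + t + u := h ▸ Multiset.le_add_right _ _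
    obtain ⟨b', b₃, rfl, h1, h2⟩ := exists_add_eq_of_le_add hb
    obtain ⟨b₁, b₂, rfl, h3, h4⟩ := exists_add_eq_of_le_add h1
    obtain ⟨s', rfl⟩ := Multiset.le_iff_exists_add.mp h3
    obtain ⟨t', rfl⟩ := Multiset.le_iff_exists_add.mp h4
    obtain ⟨u', rfl⟩ := Multiset.le_iff_exists_add.mp h2
    have hsum : P.sum = s' + t' + u' := by
      have h' : (b₁ + b₂ + b₃) + P.sum = (b₁ + b₂ + b₃) + (s' + t' + u') := by rw [h]; abel
      exact add_left_cancel h'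
    obtain ⟨D, g1, g2, g3⟩ := ih hsum (fun b hb => hP b (by simp [hb]))
      (fun x hx => hs x (Multiset.mem_add.mpr (Or.inr hx)))
      (fun x hx => ht x (Multiset.mem_add.mpr (Or.inr hx)))
      (fun x hx => hu x (Multiset.mem_add.mpr (Or.inr hx)))
    refine ⟨⟨b₁, b₂, b₃.sum⟩ :: D, by simp [g1], ?_, ?_⟩
    · intro d hd
      rcases List.mem_cons.mp hd with rfl | hd
      · refine ⟨fun x hx => hs x (Multiset.mem_add.mpr (Or.inl hx)),
          fun x hx => ht x (Multiset.mem_add.mpr (Or.inl hx)),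
          Multiset.sum_nonneg fun x hx => hu x (Multiset.mem_add.mpr (Or.inl hx)), ?_⟩
        have := hP _ (List.mem_cons_self)
        rwa [Multiset.sum_add, Multiset.sum_add] at this
      · exact g2 d hd
    · rw [List.map_cons, List.sum_cons, g3]
      funext i
      fin_cases i <;> simp [BinPattern.data, BinPattern.share]

/-- The average of a list of points is a convex combination of few of them. -/
theorem exists_convex_combination {α : Type*} {n : ℕ} (f : α → Fin n → ℝ) (D : List α)
    (hD : D ≠ []) :
    ∃ (ι : Type) (_ : Fintype ι) (d : ι → α) (θ : ι → ℝ), Fintype.card ι ≤ n + 1 ∧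
      (∀ i, d i ∈ D) ∧ (∀ i, 0 ≤ θ i) ∧ ∑ i, θ i = 1 ∧
      ∀ j, (D.length : ℝ) * ∑ i, θ i * f (d i) j = (D.map f).sum j := by
  have hlen : (0 : ℝ) < D.length := by exact_mod_cast List.length_pos_of_ne_nil hD
  have hmem : ∑ i : Fin D.length, ((D.length : ℝ)⁻¹) • f (D.get i) ∈
      convexHull ℝ (f '' {a | a ∈ D}) := by
    refine (convex_convexHull ℝ _).sum_mem (fun _ _ => by positivity) ?_ fun i _ =>
      subset_convexHull ℝ _ ⟨D.get i, List.get_mem _ _, rfl⟩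
    simp [hlen.ne']
  -- Carathéodory's theorem: affinely independent points in dimension `n` are at most `n + 1`.
  obtain ⟨ι, _, z, θ, h1, h2, h3, h4, h5⟩ := eq_pos_convex_span_of_mem_convexHull hmem
  choose d hd1 hd2 using fun i => h1 ⟨i, rfl⟩
  refine ⟨Fin (Fintype.card ι), inferInstance, d ∘ (Fintype.equivFin ι).symm,
    θ ∘ (Fintype.equivFin ι).symm, ?_, fun i => hd1 _, fun i => (h3 _).le, ?_, fun j => ?_⟩
  · have := h2.card_le_finrank_succ
    have h6 := Submodule.finrank_le (vectorSpan ℝ (Set.range z))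
    rw [Module.finrank_fin_fun] at h6
    rw [Fintype.card_fin]
    omega
  · rw [← h4]
    exact (Fintype.equivFin ι).symm.sum_comp θ
  · have h6 : ∑ i, θ i * f (d i) j = (D.length : ℝ)⁻¹ * (D.map f).sum j := by
      have := congrFun h5 j
      rw [← Finset.smul_sum, ← List.sum_ofFn] at this
      simp only [Finset.sum_apply, Pi.smul_apply, smul_eq_mul] at this
      rw [← List.ofFn_get D, List.map_ofFn]
      simp only [hd2, List.ofFn_get]
      rw [this]
      rfl
    have h7 := (Fintype.equivFin ι).symm.sum_comp fun i => θ i * f (d i) j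
    simp only [Function.comp_apply]
    rw [h7, h6, mul_inv_cancel_left₀ hlen.ne']

/-- From any list one gets lists for all numbers `m` of bins on which HARMONIC performs almost as
badly. -/
theorem exists_list_of_list {L₀ : List ℝ} (hL₀ : UnitWeights L₀) (hN : 0 < minBins L₀) (m : ℕ) :
    ∃ L : List ℝ, UnitWeights L ∧ minBins L ≤ m + 5 ∧
      m * ((harmonicBins 12 L₀ : ℝ) - 13) ≤ minBins L₀ * ((harmonicBins 12 L : ℝ) + 16) := by
  obtain ⟨P, hPlen, hPsum, hP⟩ := (packable_minBins fun x hx => (hL₀ x hx).2).exists_length_eq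
  set S := L₀.filter fun x => itemType 12 x = 12 with hS
  set B := L₀.filter fun x => ¬ itemType 12 x = 12 with hB
  have hSmem : ∀ x ∈ S, 0 ≤ x ∧ x ≤ 1 / 12 := fun x hx => by
    refine ⟨(hL₀ x (List.mem_of_mem_filter hx)).1, ?_⟩
    simpa using le_of_itemType_eq (M := 12) (by norm_num) (by simpa using (List.mem_filter.mp hx).2)
  have hBmem : ∀ x ∈ B, 1 / 12 < x ∧ x ≤ 1 := fun x hx => by
    refine ⟨?_, (hL₀ x (List.mem_of_mem_filter hx)).2⟩
    have h1 : ¬ itemType 12 x = 12 := by simpa using (List.mem_filter.mp hx).2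
    exact not_le.mp fun h => h1 (itemType_twelve_of_le h)
  obtain ⟨O, F, hOF, hO1, hO2, hO3⟩ := exists_openers S fun x hx =>
    ⟨(hSmem x hx).1, by linarith [(hSmem x hx).2]⟩
  have hsum : P.sum = (B : Multiset ℝ) + O + F := by
    rw [hPsum, add_assoc, hOF, add_comm, hS, hB, ← Multiset.filter_coe, ← Multiset.filter_coe,
      Multiset.filter_add_not]
  have hmemS : ∀ x ∈ O + F, 0 ≤ x ∧ x ≤ 1 / 12 := fun x hx => hSmem x (by
    rw [hOF] at hx; simpa using hx)
  obtain ⟨D, hDlen, hDvalid, hDsum⟩ := exists_patterns_of_packing P hsum hP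
    (fun x hx => hBmem x (by simpa using hx))
    (fun x hx => ⟨hO3 x hx, (hmemS x (Multiset.mem_add.mpr (Or.inl hx))).2⟩)
    (fun x hx => (hmemS x (Multiset.mem_add.mpr (Or.inr hx))).1)
  rw [hPlen] at hDlen
  obtain ⟨ι, _, d, θ, hι, hdD, hθ, hθ1, hdata⟩ := exists_convex_combination BinPattern.data D
    (by rintro rfl; simp at hDlen; omega)
  rw [hDlen, hDsum] at hdata
  have hN' : (0 : ℝ) < minBins L₀ := by exact_mod_cast hN
  have e0 := hdata 0
  have e1 := hdata 1
  have e2 := hdata 2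
  have e3 := hdata 3
  simp only [BinPattern.data, Matrix.cons_val] at e0 e1 e2 e3
  -- The opener inequality for the whole list, divided by the number of bins, is the inequality
  -- required of the convex combination. With at most five patterns the errors are 5 bins and `3 * 5
  -- + 1 = 16`.
  obtain ⟨L, h1, h2, h3⟩ := exists_list_of_combination d (fun i => hDvalid _ (hdD i)) θ hθ hθ1 (by
    refine le_of_mul_le_mul_left ?_ hN'
    rw [mul_add, mul_left_comm, e1, e2, e3]
    exact hO2) m
  refine ⟨L, h1, minBins_le_of_packable (h2.mono (by omega)), ?_⟩
  have h4 := harmonicBins_le_binShare (M := 12) (by norm_num) hL₀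
  have h5 : ((B : Multiset ℝ).map (binShare 12)).sum = (L₀.map (binShare 12)).sum := by
    rw [Multiset.map_coe, Multiset.sum_coe, hB]
    clear * -
    induction L₀ with
    | nil => simp
    | cons x L ih =>
      by_cases h : itemType 12 x = 12
      · simpa [h, binShare] using ih
      · simpa [h] using ih
  have h6 : (nextFit none S : ℝ) ≤ Multiset.card O + 1 := by exact_mod_cast hO1
  have h7 : (Fintype.card ι : ℝ) ≤ 5 := by exact_mod_cast hι
  rw [h5] at e0
  calc (m : ℝ) * ((harmonicBins 12 L₀ : ℝ) - 13)
      ≤ m * ((L₀.map (binShare 12)).sum + Multiset.card O) := by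
        refine mul_le_mul_of_nonneg_left ?_ (by positivity)
        push_cast at h4
        linarith
    _ = minBins L₀ * (m * (∑ i, θ i * (d i).share + ∑ i, θ i * Multiset.card (d i).openers)) := by
        rw [← e0, ← e1]; ring
    _ ≤ _ := mul_le_mul_of_nonneg_left (by linarith) hN'.le

/-! ### Bounds for the ratio, and lists that attain it -/

theorem le_of_forall_nat_mul_le {a b c : ℝ} (h : ∀ m : ℕ, m * a ≤ m * b + c) : a ≤ b := by
  by_contra! hab
  obtain ⟨m, hm⟩ := exists_nat_gt (c / (a - b))
  rw [div_lt_iff₀ (by linarith)] at hm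
  linarith [h m]

theorem harmonicBins_eq_zero {L : List ℝ} (hL : UnitWeights L) (h : minBins L = 0) (M : ℕ) :
    harmonicBins M L = 0 := by
  obtain ⟨P, h1, h2, -⟩ := packable_minBins fun x hx => (hL x hx).2
  rw [h, Nat.le_zero, List.length_eq_zero_iff] at h1
  subst h1
  have : L = [] := by simpa using h2.symm
  subst this
  rfl

/-- The ratios that appear in the definition of `harmonicRatio`. -/
def IsAdmissibleRatio (M : ℕ) (r : ℝ) : Prop :=
  ∃ c : ℝ, ∀ L : List ℝ, UnitWeights L → (harmonicBins M L : ℝ) ≤ r * minBins L + c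

theorem isAdmissibleRatio_twelve : IsAdmissibleRatio 12 (1 + 1 / 2 + 1 / 6 + 2 / 77) :=
  ⟨13, fun _ hL => harmonicBins_twelve_le hL⟩

/-- The two patterns behind the lower bound for the ratio of HARMONIC with 12 types. -/
noncomputable def extremalPattern : Bool → BinPattern
  | true => ⟨{1 / 2 + 1 / 1000000, 1 / 3 + 1 / 1000000, 1 / 7 + 1 / 1000000}, 0,
      1 / 42 - 3 / 1000000⟩
  | false => ⟨{1 / 2 + 1 / 1000000, 1 / 3 + 1 / 1000000},
      {1 / 12 - 1 / 1000000, 1 / 12 - 1 / 1000000}, 0⟩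

theorem extremalPattern_valid (b : Bool) : (extremalPattern b).Valid := by
  cases b
  · refine ⟨?_, ?_, ?_, ?_⟩
    all_goals norm_num [extremalPattern]
  · refine ⟨?_, ?_, ?_, ?_⟩
    all_goals norm_num [extremalPattern]

theorem binShare_eq {M i : ℕ} (hi : 0 < i) (hi' : i < M) {x : ℝ}
    (h1 : 1 / ((i : ℝ) + 1) < x) (h2 : x ≤ 1 / (i : ℝ)) : binShare M x = 1 / i := by
  rw [binShare, itemType_eq_of_mem hi hi' h1 h2, if_neg hi'.ne]

theorem share_extremalPattern (b : Bool) :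
    (extremalPattern b).share = if b then 1 + 1 / 2 + 1 / 6 else 1 + 1 / 2 := by
  have h1 : binShare 12 (1 / 2 + 1 / 1000000) = 1 := by
    rw [binShare_eq (i := 1)] <;> norm_num
  have h2 : binShare 12 (1 / 3 + 1 / 1000000) = 1 / 2 := by
    rw [binShare_eq (i := 2)] <;> norm_num
  have h3 : binShare 12 (1 / 7 + 1 / 1000000) = 1 / 6 := by
    rw [binShare_eq (i := 6)] <;> norm_num
  cases b
  · simp only [BinPattern.share, extremalPattern, Multiset.insert_eq_cons, Multiset.map_cons,
      Multiset.map_singleton, Multiset.sum_cons, Multiset.sum_singleton, h1, h2]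
    norm_num
  · simp only [BinPattern.share, extremalPattern, Multiset.insert_eq_cons, Multiset.map_cons,
      Multiset.map_singleton, Multiset.sum_cons, Multiset.sum_singleton, h1, h2, h3]
    norm_num

/-- An opener close to 1/12 needs about 5/6 of sand. The two openers in one `false` bin thus use up
the 1/42 of sand in 70 `true` bins; the proportion 701 : 10 leaves room for the perturbations by
1/1000000. Per bin this gives (701 · 5/3 + 10 · (3/2 + 2)) / 711 = 3610/2133. -/
theorem exists_list_of_extremalPattern (m : ℕ) :
    ∃ L : List ℝ, UnitWeights L ∧ minBins L ≤ m + 2 ∧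
      m * (3610 / 2133 : ℝ) ≤ harmonicBins 12 L + 7 := by
  obtain ⟨L, h1, h2, h3⟩ := exists_list_of_combination extremalPattern extremalPattern_valid
    (fun b => if b then 701 / 711 else 10 / 711) (fun b => by split_ifs <;> norm_num)
    (by norm_num) (by norm_num [extremalPattern]) m
  refine ⟨L, h1, minBins_le_of_packable (by simpa using h2), ?_⟩
  simp only [share_extremalPattern, Fintype.sum_bool] at h3
  simp only [extremalPattern] at h3
  norm_num at h3
  linarith

theorem IsAdmissibleRatio.le {r : ℝ} (h : IsAdmissibleRatio 12 r) : 3610 / 2133 ≤ r := by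
  obtain ⟨c, hc⟩ := h
  -- The sign of `r` is not known, and `minBins L` is only bounded above; `max r 0` allows the bound
  -- to be multiplied.
  have key : (3610 / 2133 : ℝ) ≤ max r 0 := by
    refine le_of_forall_nat_mul_le (c := 2 * max r 0 + c + 7) fun m => ?_
    obtain ⟨L, h1, h2, h3⟩ := exists_list_of_extremalPattern m
    have h4 := hc L h1
    have h5 : (minBins L : ℝ) ≤ m + 2 := by exact_mod_cast h2
    have h6 : r * minBins L ≤ max r 0 * minBins L :=
      mul_le_mul_of_nonneg_right (le_max_left _ _) (by positivity)
    have h7 := mul_le_mul_of_nonneg_left h5 (le_max_right r 0)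
    linarith
  rcases le_max_iff.mp key with h | h
  · exact h
  · norm_num at h

/-- The admissible ratios are nonempty and bounded below, so `sInf` is a true infimum and not a
default value. -/
theorem harmonicRatio_twelve_mem :
    3610 / 2133 ≤ harmonicRatio 12 ∧ harmonicRatio 12 ≤ 1 + 1 / 2 + 1 / 6 + 2 / 77 :=
  ⟨le_csInf ⟨_, isAdmissibleRatio_twelve⟩ fun _ hr => IsAdmissibleRatio.le hr,
    csInf_le ⟨3610 / 2133, fun _ hr => IsAdmissibleRatio.le hr⟩ isAdmissibleRatio_twelve⟩

theorem harmonicRatio_le_of_isAdmissibleRatio {r : ℝ} (h : IsAdmissibleRatio 12 r) :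
    harmonicRatio 12 ≤ r :=
  csInf_le ⟨3610 / 2133, fun _ hr => IsAdmissibleRatio.le hr⟩ h

/-- Every admissible ratio works with the same additive constant 12, so the estimate survives the
passage to the infimum. -/
theorem harmonicBins_le_harmonicRatio {L : List ℝ} (hL : UnitWeights L) :
    (harmonicBins 12 L : ℝ) ≤ harmonicRatio 12 * minBins L + 12 := by
  refine le_of_forall_pos_le_add fun ε hε => ?_
  have hN : (0 : ℝ) ≤ minBins L := by positivity
  obtain ⟨r, ⟨c, hc⟩, hr⟩ := exists_lt_of_csInf_lt (s := {r | IsAdmissibleRatio 12 r})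
    ⟨_, isAdmissibleRatio_twelve⟩
    (show harmonicRatio 12 < harmonicRatio 12 + ε / (minBins L + 1) by
      have : 0 < ε / (minBins L + 1) := by positivity
      linarith)
  have hr0 : 0 ≤ r := le_trans (by norm_num) (IsAdmissibleRatio.le ⟨c, hc⟩)
  have h1 := harmonicBins_le_of_admissible (M := 12) (by norm_num) hc hr0 hL
  have h2 : r * minBins L ≤ (harmonicRatio 12 + ε / (minBins L + 1)) * minBins L :=
    mul_le_mul_of_nonneg_right hr.le hN
  have h3 : ε / (minBins L + 1) * minBins L ≤ ε := by
    rw [div_mul_eq_mul_div, div_le_iff₀ (by positivity)]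
    nlinarith
  push_cast at h1
  linarith

theorem exists_list_harmonicRatio_add_five {m : ℕ} (hm : 0 < m) :
    ∃ L : List ℝ, UnitWeights L ∧ minBins L ≤ m + 5 ∧
      harmonicRatio 12 * m ≤ harmonicBins 12 L + 17 := by
  by_contra! hcon
  have hm' : (0 : ℝ) < m := by exact_mod_cast hm
  -- If all lists with at most `m + 5` bins fell short, rescaling an arbitrary `L₀` to such a list
  -- would improve the ratio by `1 / m` for all lists, contradicting the infimum.
  have hadm : IsAdmissibleRatio 12 (harmonicRatio 12 - 1 / m) := by
    refine ⟨13, fun L₀ hL₀ => ?_⟩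
    rcases Nat.eq_zero_or_pos (minBins L₀) with h0 | hN
    · rw [harmonicBins_eq_zero hL₀ h0, h0]; norm_num
    · obtain ⟨L, h1, h2, h3⟩ := exists_list_of_list hL₀ hN m
      have h4 := hcon L h1 h2
      have h5 : (minBins L₀ : ℝ) * ((harmonicBins 12 L : ℝ) + 16) ≤
          minBins L₀ * (harmonicRatio 12 * m - 1) :=
        mul_le_mul_of_nonneg_left (by linarith) (by positivity)
      have h6 : (harmonicBins 12 L₀ : ℝ) - 13 ≤ (harmonicRatio 12 - 1 / m) * minBins L₀ := by
        refine le_of_mul_le_mul_left ((h3.trans h5).trans (le_of_eq ?_)) hm'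
        field_simp
      linarith
  have := harmonicRatio_le_of_isAdmissibleRatio hadm
  have : 0 < 1 / (m : ℝ) := by positivity
  linarith

/-- The ratio is attained for every number of bins, up to an additive constant. -/
theorem exists_list_harmonicRatio (m : ℕ) :
    ∃ L : List ℝ, UnitWeights L ∧ minBins L ≤ m ∧
      harmonicRatio 12 * m ≤ harmonicBins 12 L + 26 := by
  obtain ⟨h1, h2⟩ := harmonicRatio_twelve_mem
  rcases Nat.lt_or_ge 5 m with h | h
  · obtain ⟨L, g1, g2, g3⟩ := exists_list_harmonicRatio_add_five (m := m - 5) (by omega)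
    refine ⟨L, g1, by omega, ?_⟩
    rw [Nat.cast_sub h.le] at g3
    push_cast at g3
    linarith
  · refine ⟨[], by simp [UnitWeights], ?_, ?_⟩
    · exact (minBins_le_of_packable (packable_zero)).trans (Nat.zero_le m)
    · have h3 : (m : ℝ) ≤ 5 := by exact_mod_cast h
      have h4 : (0 : ℝ) ≤ harmonicBins 12 [] := by positivity
      nlinarith

/-! ### The coloring algorithm simulates HARMONIC -/

open scoped Classical in
/-- The colors of the edges at `v`. -/
noncomputable def ColoringState.colorsAt {V : Type*} (S : ColoringState V) (v : V) : Finset ℕ :=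
  ((S.colored.filter fun p => v ∈ p.1.ends).map Prod.snd).toFinset

open scoped Classical in
/-- The colors of all edges. -/
noncomputable def ColoringState.colors {V : Type*} (S : ColoringState V) : Finset ℕ :=
  (S.colored.map Prod.snd).toFinset

theorem ColoringState.isEmptyAt_iff {V : Type*} (S : ColoringState V) (v : V) (c : ℕ) :
    S.IsEmptyAt v c ↔ c ∉ S.colorsAt v := by
  simp only [IsEmptyAt, colorsAt, List.mem_toFinset, List.mem_map, List.mem_filter, decide_eq_true_eq]
  constructor
  · rintro h ⟨p, ⟨h1, h2⟩, h3⟩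
    exact h p h1 h2 h3
  · exact fun h p h1 h2 h3 => h ⟨p, ⟨h1, h2⟩, h3⟩

theorem ColoringState.load_eq_zero {V : Type*} {S : ColoringState V} {v : V} {c : ℕ}
    (h : c ∉ S.colorsAt v) : S.load v c = 0 := by
  rw [← isEmptyAt_iff] at h
  unfold load
  rw [List.filter_eq_nil_iff.mpr]
  · simp
  · intro p hp
    simpa using h p hp

theorem ColoringState.newColor_eq {V : Type*} {S : ColoringState V} {x y : V} {n : ℕ} {a : ℝ}
    (h : S.colorsAt x ∪ S.colorsAt y = Finset.Icc 1 n) : S.newColor ⟨s(x, y), a⟩ = n + 1 := by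
  have : {c : ℕ | 1 ≤ c ∧ ∀ v ∈ s(x, y), S.IsEmptyAt v c} = Set.Ici (n + 1) := by
    ext c
    have hc : c ∈ S.colorsAt x ∪ S.colorsAt y ↔ c ∈ Finset.Icc 1 n := by rw [h]
    rw [Finset.mem_union, Finset.mem_Icc] at hc
    simp only [Sym2.mem_iff, forall_eq_or_imp, forall_eq, isEmptyAt_iff, Set.mem_Ici]
    change (1 ≤ c ∧ c ∉ S.colorsAt x ∧ c ∉ S.colorsAt y) ↔ _
    rw [← not_or, hc]
    omega
  unfold newColor
  rw [this]
  exact csInf_Ici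

/-- The open colors between `x` and `y` correspond to the open bins of HARMONIC. -/
structure Simulates {V : Type*} (S : ColoringState V) (x y : V) (level : ℕ → Option ℝ) (n : ℕ) :
    Prop where
  union_eq : S.colorsAt x ∪ S.colorsAt y = Finset.Icc 1 n
  none_iff : ∀ i, level i = none ↔ S.openColor s(x, y) i = none
  load_eq : ∀ i c l, S.openColor s(x, y) i = some c → level i = some l →
    S.load x c = l ∧ S.load y c = l
  mem : ∀ i c, S.openColor s(x, y) i = some c → c ∈ S.colorsAt x ∧ c ∈ S.colorsAt y
  inj : ∀ i j c, S.openColor s(x, y) i = some c → S.openColor s(x, y) j = some c → i = j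

section Step

variable {V : Type*} {M : ℕ} {S : ColoringState V} {x y : V} {a : ℝ}

theorem ColoringState.colors_step (e : WEdge V) :
    (S.step M e).colors = insert (S.chooseColor M e) S.colors := by
  simp [colors, step]

theorem ColoringState.colorsAt_step_of_mem (e : WEdge V) {v : V} (hv : v ∈ e.ends) :
    (S.step M e).colorsAt v = insert (S.chooseColor M e) (S.colorsAt v) := by
  simp [colorsAt, step, hv]

theorem ColoringState.colorsAt_step_of_notMem (e : WEdge V) {v : V} (hv : v ∉ e.ends) :
    (S.step M e).colorsAt v = S.colorsAt v := by
  simp [colorsAt, step, hv]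

theorem ColoringState.load_step_self (e : WEdge V) {v : V} (hv : v ∈ e.ends) :
    (S.step M e).load v (S.chooseColor M e) = e.weight + S.load v (S.chooseColor M e) := by
  simp [load, step, hv]

theorem ColoringState.load_step_of_ne (e : WEdge V) {v : V} {c : ℕ}
    (hc : c ≠ S.chooseColor M e) : (S.step M e).load v c = S.load v c := by
  simp [load, step, hc.symm]

theorem ColoringState.openColor_step_of_ne (e : WEdge V) {p : Sym2 V} (hp : p ≠ e.ends) :
    (S.step M e).openColor p = S.openColor p := by
  simp [step, hp]

theorem ColoringState.openColor_step_self (e : WEdge V) :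
    (S.step M e).openColor e.ends = Function.update (S.openColor e.ends) (itemType M e.weight)
      (some (S.chooseColor M e)) := by
  simp [step]

theorem Simulates.step_open {level : ℕ → Option ℝ} {n : ℕ} (h : Simulates S x y level n)
    {l : ℝ} (hl : level (itemType M a) = some l) (hla : l + a ≤ 1) :
    ∃ c, S.openColor s(x, y) (itemType M a) = some c ∧ S.chooseColor M ⟨s(x, y), a⟩ = c := by
  obtain ⟨c, hc⟩ := Option.ne_none_iff_exists'.mp (fun hn => by
    rw [← h.none_iff, hl] at hn; exact absurd hn (by simp) :
      S.openColor s(x, y) (itemType M a) ≠ none)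
  refine ⟨c, hc, ?_⟩
  obtain ⟨h1, h2⟩ := h.load_eq _ _ _ hc hl
  have : S.CanColor ⟨s(x, y), a⟩ c := by
    intro v hv
    rcases Sym2.mem_iff.mp hv with rfl | rfl
    · rw [h1]; exact hla
    · rw [h2]; exact hla
  simp only [ColoringState.chooseColor, hc, this, if_true]

theorem Simulates.step_new {level : ℕ → Option ℝ} {n : ℕ} (h : Simulates S x y level n)
    (hl : ∀ l, level (itemType M a) = some l → 1 < l + a) :
    S.chooseColor M ⟨s(x, y), a⟩ = n + 1 := by
  unfold ColoringState.chooseColor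
  cases hc : S.openColor s(x, y) (itemType M a) with
  | none => simpa only [hc] using ColoringState.newColor_eq h.union_eq
  | some c =>
    obtain ⟨l, hl'⟩ := Option.ne_none_iff_exists'.mp (fun hn => by
      rw [h.none_iff, hc] at hn; exact absurd hn (by simp) : level (itemType M a) ≠ none)
    have : ¬ S.CanColor ⟨s(x, y), a⟩ c := fun hcan => by
      have h1 := hcan x (by simp)
      rw [(h.load_eq _ _ _ hc hl').1] at h1
      exact absurd h1 (not_le.mpr (hl l hl'))
    simpa only [hc, this, if_false] using ColoringState.newColor_eq h.union_eq

theorem Simulates.le {level : ℕ → Option ℝ} {n : ℕ} (h : Simulates S x y level n) {i c : ℕ}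
    (hc : S.openColor s(x, y) i = some c) : c ∈ Finset.Icc 1 n := by
  rw [← h.union_eq]
  exact Finset.mem_union_left _ (h.mem i c hc).1

/-- Hypothesis `hc` says that the chosen color is not open for another type; so the loads of the
other open colors do not change, and open colors of different types stay different. -/
theorem Simulates.update {level : ℕ → Option ℝ} {n n' : ℕ} (h : Simulates S x y level n) {l : ℝ}
    (hunion : insert (S.chooseColor M ⟨s(x, y), a⟩) (Finset.Icc 1 n) = Finset.Icc 1 n')
    (hx : a + S.load x (S.chooseColor M ⟨s(x, y), a⟩) = l)
    (hy : a + S.load y (S.chooseColor M ⟨s(x, y), a⟩) = l)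
    (hc : ∀ i, i ≠ itemType M a →
      S.openColor s(x, y) i ≠ some (S.chooseColor M ⟨s(x, y), a⟩)) :
    Simulates (S.step M ⟨s(x, y), a⟩) x y (Function.update level (itemType M a) (some l)) n' := by
  set e : WEdge V := ⟨s(x, y), a⟩ with he
  have hxe : x ∈ e.ends := by simp [he]
  have hye : y ∈ e.ends := by simp [he]
  have hopen := ColoringState.openColor_step_self (M := M) (S := S) e
  change (S.step M e).openColor s(x, y) = Function.update (S.openColor s(x, y)) (itemType M a)
    (some (S.chooseColor M e)) at hopen
  refine ⟨?_, fun i => ?_, fun i c l' => ?_, fun i c => ?_, fun i j c => ?_⟩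
  · rw [ColoringState.colorsAt_step_of_mem e hxe, ColoringState.colorsAt_step_of_mem e hye,
      ← Finset.insert_union_distrib, h.union_eq, hunion]
  · rw [hopen]
    by_cases hi : i = itemType M a
    · subst hi; simp
    · simp [hi, h.none_iff]
  · rw [hopen]
    by_cases hi : i = itemType M a
    · subst hi
      simp only [Function.update_self, Option.some.injEq]
      rintro rfl rfl
      rw [ColoringState.load_step_self e hxe, ColoringState.load_step_self e hye]
      exact ⟨hx, hy⟩
    · rw [Function.update_of_ne hi, Function.update_of_ne hi]
      intro h1 h2
      have hne : c ≠ S.chooseColor M e := fun hne => hc i hi (hne ▸ h1)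
      rw [ColoringState.load_step_of_ne e hne, ColoringState.load_step_of_ne e hne]
      exact h.load_eq i c l' h1 h2
  · rw [hopen]
    by_cases hi : i = itemType M a
    · subst hi
      simp only [Function.update_self, Option.some.injEq]
      rintro rfl
      rw [ColoringState.colorsAt_step_of_mem e hxe, ColoringState.colorsAt_step_of_mem e hye]
      exact ⟨Finset.mem_insert_self _ _, Finset.mem_insert_self _ _⟩
    · rw [Function.update_of_ne hi, ColoringState.colorsAt_step_of_mem e hxe,
        ColoringState.colorsAt_step_of_mem e hye]
      exact fun h1 => ⟨Finset.mem_insert_of_mem (h.mem i c h1).1,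
        Finset.mem_insert_of_mem (h.mem i c h1).2⟩
  · rw [hopen]
    by_cases hi : i = itemType M a <;> by_cases hj : j = itemType M a
    · exact fun _ _ => hi.trans hj.symm
    · subst hi
      rw [Function.update_self, Function.update_of_ne hj]
      rintro h1 h2
      exact absurd (h2.trans h1.symm) (hc j hj)
    · subst hj
      rw [Function.update_self, Function.update_of_ne hi]
      rintro h1 h2
      exact absurd (h1.trans h2.symm) (hc i hi)
    · rw [Function.update_of_ne hi, Function.update_of_ne hj]
      exact h.inj i j c

end Step

/-- `S'` arises from `S` by coloring edges between `x` and `y`, with new colors `n + 1, …, n'`. -/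
structure ExtendsColoring {V : Type*} (S S' : ColoringState V) (x y : V) (n n' : ℕ) : Prop where
  le : n ≤ n'
  colors : S'.colors = S.colors ∪ Finset.Ioc n n'
  left : S'.colorsAt x = S.colorsAt x ∪ Finset.Ioc n n'
  right : S'.colorsAt y = S.colorsAt y ∪ Finset.Ioc n n'
  other : ∀ z, z ≠ x → z ≠ y → S'.colorsAt z = S.colorsAt z
  openColor : ∀ p, p ≠ s(x, y) → S'.openColor p = S.openColor p

section Run

variable {V : Type*} {M : ℕ} {S S' S'' : ColoringState V} {x y : V} {a : ℝ}

theorem ExtendsColoring.refl (S : ColoringState V) (x y : V) (n : ℕ) :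
    ExtendsColoring S S x y n n :=
  ⟨le_rfl, by simp, by simp, by simp, fun _ _ _ => rfl, fun _ _ => rfl⟩

theorem ExtendsColoring.trans {n n' n'' : ℕ} (h : ExtendsColoring S S' x y n n')
    (h' : ExtendsColoring S' S'' x y n' n'') : ExtendsColoring S S'' x y n n'' := by
  have hu := Finset.Ioc_union_Ioc_eq_Ioc h.le h'.le
  refine ⟨h.le.trans h'.le, ?_, ?_, ?_, fun z hx hy => ?_, fun p hp => ?_⟩
  · rw [h'.colors, h.colors, Finset.union_assoc, hu]
  · rw [h'.left, h.left, Finset.union_assoc, hu]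
  · rw [h'.right, h.right, Finset.union_assoc, hu]
  · rw [h'.other z hx hy, h.other z hx hy]
  · rw [h'.openColor p hp, h.openColor p hp]

theorem ColoringState.colorsAt_subset (S : ColoringState V) (v : V) : S.colorsAt v ⊆ S.colors := by
  intro c
  simp only [colorsAt, colors, List.mem_toFinset, List.mem_map]
  rintro ⟨p, hp, rfl⟩
  exact ⟨p, List.mem_of_mem_filter hp, rfl⟩

/-- The set `T` stands for the colors at `x`, at `y`, or of all edges, so that the three color sets
are updated by one hypothesis. -/
theorem extendsColoring_step {n n' : ℕ} (hle : n ≤ n')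
    (h : ∀ T : Finset ℕ, S.colorsAt x ⊆ T ∨ S.colorsAt y ⊆ T →
      insert (S.chooseColor M ⟨s(x, y), a⟩) T = T ∪ Finset.Ioc n n') :
    ExtendsColoring S (S.step M ⟨s(x, y), a⟩) x y n n' := by
  refine ⟨hle, ?_, ?_, ?_, fun z hx hy => ?_, fun p hp => ?_⟩
  · rw [ColoringState.colors_step, h _ (Or.inl (S.colorsAt_subset x))]
  · rw [ColoringState.colorsAt_step_of_mem _ (by simp), h _ (Or.inl subset_rfl)]
  · rw [ColoringState.colorsAt_step_of_mem _ (by simp), h _ (Or.inr subset_rfl)]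
  · exact ColoringState.colorsAt_step_of_notMem _ (by simp [hx, hy])
  · exact ColoringState.openColor_step_of_ne _ hp

theorem Simulates.exists_step {level : ℕ → Option ℝ} {n : ℕ} (h : Simulates S x y level n)
    {l : ℝ} (hl : level (itemType M a) = some l) (hla : l + a ≤ 1) :
    Simulates (S.step M ⟨s(x, y), a⟩) x y (Function.update level (itemType M a) (some (l + a))) n ∧
      ExtendsColoring S (S.step M ⟨s(x, y), a⟩) x y n n := by
  obtain ⟨c, hc, hcc⟩ := h.step_open hl hla
  obtain ⟨h1, h2⟩ := h.load_eq _ _ _ hc hl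
  constructor
  · refine h.update ?_ ?_ ?_ fun i hi h' => hi ?_
    · rw [hcc]; exact Finset.insert_eq_of_mem (h.le hc)
    · rw [hcc, h1, add_comm]
    · rw [hcc, h2, add_comm]
    · rw [hcc] at h'
      exact h.inj _ _ _ h' hc
  · refine extendsColoring_step le_rfl fun T hT => ?_
    rw [hcc, Finset.Ioc_self, Finset.union_empty]
    refine Finset.insert_eq_of_mem ?_
    rcases hT with hT | hT
    exacts [hT (h.mem _ _ hc).1, hT (h.mem _ _ hc).2]

theorem Simulates.exists_step_new {level : ℕ → Option ℝ} {n : ℕ} (h : Simulates S x y level n)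
    (hl : ∀ l, level (itemType M a) = some l → 1 < l + a) :
    Simulates (S.step M ⟨s(x, y), a⟩) x y (Function.update level (itemType M a) (some a)) (n + 1) ∧
      ExtendsColoring S (S.step M ⟨s(x, y), a⟩) x y n (n + 1) := by
  have hcc := h.step_new hl
  have hnot : n + 1 ∉ S.colorsAt x ∪ S.colorsAt y := by
    rw [h.union_eq, Finset.mem_Icc]; omega
  rw [Finset.mem_union, not_or] at hnot
  constructor
  · refine h.update ?_ ?_ ?_ fun i hi h' => ?_
    · rw [hcc]
      ext c
      simp only [Finset.mem_insert, Finset.mem_Icc]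
      omega
    · rw [hcc, ColoringState.load_eq_zero hnot.1, add_zero]
    · rw [hcc, ColoringState.load_eq_zero hnot.2, add_zero]
    · rw [hcc] at h'
      exact hnot.1 (h.mem _ _ h').1
  · refine extendsColoring_step (Nat.le_succ n) fun T _ => ?_
    have : Finset.Ioc n (n + 1) = {n + 1} := by
      ext c
      simp only [Finset.mem_Ioc, Finset.mem_singleton]
      omega
    rw [hcc, this, Finset.insert_eq, Finset.union_comm]

theorem Simulates.run {level : ℕ → Option ℝ} {n : ℕ} (h : Simulates S x y level n) (L : List ℝ) :
    ExtendsColoring S ((L.map fun b => (⟨s(x, y), b⟩ : WEdge V)).foldl (ColoringState.step M) S)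
      x y n (n + harmonicFrom M level L) := by
  induction L generalizing S level n with
  | nil => exact ExtendsColoring.refl _ _ _ _
  | cons b L ih =>
    rw [List.map_cons, List.foldl_cons]
    rw [harmonicFrom]
    cases hl : level (itemType M b) with
    | none =>
      obtain ⟨h1, h2⟩ := h.exists_step_new (a := b) (M := M) (by simp [hl])
      have := h2.trans (ih h1)
      rwa [add_assoc, add_comm 1] at this
    | some l =>
      by_cases hlb : l + b ≤ 1
      · obtain ⟨h1, h2⟩ := h.exists_step hl hlb
        simpa only [hlb, if_true] using h2.trans (ih h1)
      · obtain ⟨h1, h2⟩ := h.exists_step_new (a := b) (M := M) (by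
          intro l' hl'
          rw [hl, Option.some.injEq] at hl'
          subst hl'
          exact not_le.mp hlb)
        have := h2.trans (ih h1)
        rw [add_assoc, add_comm 1] at this
        simpa only [hlb, if_false] using this

/-- Without open colors between `x` and `y` the simulation starts with no open bins. Earlier colors
at `x` and `y` matter only through their union, an initial segment, which makes the new colors
consecutive. -/
theorem extendsColoring_run {n : ℕ} (hunion : S.colorsAt x ∪ S.colorsAt y = Finset.Icc 1 n)
    (hopen : S.openColor s(x, y) = fun _ => none) (L : List ℝ) :
    ExtendsColoring S ((L.map fun b => (⟨s(x, y), b⟩ : WEdge V)).foldl (ColoringState.step M) S)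
      x y n (n + harmonicBins M L) :=
  Simulates.run ⟨hunion, by simp [hopen], by simp [hopen], by simp [hopen], by simp [hopen]⟩ L

end Run

/-! ### Colors used on a hub sequence -/

section Hub

variable {n M : ℕ}

/-- The state in which no edge has arrived. -/
def initialState (V : Type*) : ColoringState V := ⟨fun _ _ => none, []⟩

/-- The state after the edges between `u i` and `v i` have arrived, for all `i` in `l`. -/
noncomputable def pairsState (M : ℕ) (A : List ℝ) (l : List (Fin n)) :
    ColoringState (HubVertex n) :=
  (l.flatMap fun i => A.map fun x => (⟨s(HubVertex.u i, HubVertex.v i), x⟩ :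
    WEdge (HubVertex n))).foldl (ColoringState.step M) (initialState _)

/-- The pairs are disjoint, so each one starts afresh and receives the same colors as the others. -/
theorem pairsState_spec (A : List ℝ) (l : List (Fin n)) (hl : l.Nodup) :
    (∀ i, (pairsState M A l).colorsAt (.u i) =
      if i ∈ l then Finset.Icc 1 (harmonicBins M A) else ∅) ∧
    (∀ i, i ∉ l → (pairsState M A l).colorsAt (.v i) = ∅) ∧
    (pairsState M A l).colorsAt .w = ∅ ∧
    (∀ p, (∀ i ∈ l, p ≠ s(.u i, .v i)) → (pairsState M A l).openColor p = fun _ => none) ∧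
    (pairsState M A l).colors = if l = [] then ∅ else Finset.Icc 1 (harmonicBins M A) := by
  induction l using List.reverseRecOn with
  | nil =>
    simp [pairsState, initialState, ColoringState.colorsAt, ColoringState.colors]
  | append_singleton l i ih =>
    rw [List.nodup_append] at hl
    have hi : i ∉ l := fun h => hl.2.2 i h i (by simp) rfl
    obtain ⟨h1, h2, h3, h4, h5⟩ := ih hl.1
    have hrun := extendsColoring_run (M := M) (n := 0) (S := pairsState M A l) (x := .u i)
      (y := .v i) (by rw [h1, h2 i hi, if_neg hi]; rfl) (h4 _ fun j hj hij => by
        have : i = j := by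
          rw [Sym2.eq_iff] at hij
          simpa using hij
        exact hi (this ▸ hj)) A
    have hst : pairsState M A (l ++ [i]) = (A.map fun b => (⟨s(HubVertex.u i, HubVertex.v i), b⟩ :
        WEdge (HubVertex n))).foldl (ColoringState.step M) (pairsState M A l) := by
      simp [pairsState, List.foldl_append]
    rw [← hst, zero_add] at hrun
    have hIoc : Finset.Ioc 0 (harmonicBins M A) = Finset.Icc 1 (harmonicBins M A) := rfl
    refine ⟨fun j => ?_, fun j hj => ?_, ?_, fun p hp => ?_, ?_⟩
    · by_cases hj : j = i
      · subst hj
        rw [hrun.left, h1, if_neg hi, Finset.empty_union, hIoc]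
        simp
      · rw [hrun.other _ (by simpa using hj) (by simp), h1]
        simp [hj]
    · rw [List.mem_append, not_or] at hj
      rw [hrun.other _ (by simp) (by simpa using hj.2), h2 j hj.1]
    · rw [hrun.other _ (by simp) (by simp), h3]
    · rw [hrun.openColor p (hp i (by simp)), h4 p fun j hj => hp j (by simp [hj])]
    · rw [hrun.colors, h5, hIoc]
      split_ifs with h6 h7 h7
      · simp at h7
      · simp
      · simp at h7
      · simp

/-- The state after all edges between `u i` and `v i`, and for all `i` in `l` the edges between the
hub and `u i` have arrived. -/
noncomputable def hubState (M : ℕ) (A B : List ℝ) (l : List (Fin n)) :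
    ColoringState (HubVertex n) :=
  (l.flatMap fun i => B.map fun x => (⟨s(HubVertex.w, HubVertex.u i), x⟩ :
    WEdge (HubVertex n))).foldl (ColoringState.step M) (pairsState M A (List.finRange n))

/-- The colors at `u i` fill the gap below those at the hub; the union is an initial segment again,
and no color can be reused by the next bundle. -/
theorem hubState_spec (hn : 0 < n) (A B : List ℝ) (l : List (Fin n)) (hl : l.Nodup) :
    (∀ i, i ∉ l → (hubState M A B l).colorsAt (.u i) = Finset.Icc 1 (harmonicBins M A)) ∧
    (hubState M A B l).colorsAt .w =
      Finset.Ioc (harmonicBins M A) (harmonicBins M A + l.length * harmonicBins M B) ∧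
    (∀ i, i ∉ l → (hubState M A B l).openColor s(.w, .u i) = fun _ => none) ∧
    (hubState M A B l).colors =
      Finset.Icc 1 (harmonicBins M A + l.length * harmonicBins M B) := by
  induction l using List.reverseRecOn with
  | nil =>
    obtain ⟨h1, -, h3, h4, h5⟩ := pairsState_spec (M := M) A (List.finRange n) (List.nodup_finRange n)
    refine ⟨fun i _ => ?_, ?_, fun i _ => ?_, ?_⟩
    · simpa [hubState] using h1 i
    · simpa [hubState] using h3
    · exact h4 _ fun j _ => by simp
    · have : List.finRange n ≠ [] := by
        rw [← List.length_pos_iff, List.length_finRange]; exact hn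
      rw [if_neg this] at h5
      simpa [hubState] using h5
  | append_singleton l i ih =>
    rw [List.nodup_append] at hl
    have hi : i ∉ l := fun h => hl.2.2 i h i (by simp) rfl
    obtain ⟨h1, h2, h3, h4⟩ := ih hl.1
    set a := harmonicBins M A
    set b := harmonicBins M B
    have hrun := extendsColoring_run (M := M) (n := a + l.length * b) (S := hubState M A B l)
      (x := .w) (y := .u i) (by
        rw [h1 i hi, h2]
        ext c
        simp only [Finset.mem_union, Finset.mem_Icc, Finset.mem_Ioc]
        omega) (h3 i hi) B
    have hst : hubState M A B (l ++ [i]) = (B.map fun b => (⟨s(HubVertex.w, HubVertex.u i), b⟩ :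
        WEdge (HubVertex n))).foldl (ColoringState.step M) (hubState M A B l) := by
      simp [hubState, List.foldl_append]
    have hlen : a + (l ++ [i]).length * b = a + l.length * b + b := by
      rw [List.length_append, List.length_singleton]; ring
    change ExtendsColoring _ _ _ _ _ (_ + b) at hrun
    rw [← hst, ← hlen] at hrun
    have hle := hrun.le
    refine ⟨fun j hj => ?_, ?_, fun j hj => ?_, ?_⟩
    · rw [List.mem_append, not_or] at hj
      rw [hrun.other _ (by simp) (by simpa using hj.2), h1 j hj.1]
    · rw [hrun.left, h2]
      exact Finset.Ioc_union_Ioc_eq_Ioc (by omega) hle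
    · rw [List.mem_append, not_or] at hj
      rw [hrun.openColor _ (by simpa using hj.2), h3 j hj.1]
    · rw [hrun.colors, h4]
      ext c
      simp only [Finset.mem_union, Finset.mem_Icc, Finset.mem_Ioc]
      omega

theorem usedColors_hubSequence (hn : 0 < n) (A B : List ℝ) :
    usedColors M (hubSequence A fun _ : Fin n => B) =
      Finset.Icc 1 (harmonicBins M A + n * harmonicBins M B) := by
  have h := (hubState_spec (M := M) hn A B (List.finRange n) (List.nodup_finRange n)).2.2.2
  rw [List.length_finRange] at h
  rw [← h]
  simp only [usedColors, ColoringState.colors, harmonicColoring, hubSequence, hubState, pairsState,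
    initialState, List.foldl_append]

end Hub

/-! ### Packing number and degrees of a hub sequence -/

theorem Packable.add_zero_item {s : Multiset ℝ} {k : ℕ} (h : Packable s k) (hk : 0 < k) :
    Packable (s + {0}) k := by
  obtain ⟨P, h1, h2, h3⟩ := h.exists_length_eq
  cases P with
  | nil => simp at h1; omega
  | cons b P =>
    refine ⟨(b + {0}) :: P, h1.le, ?_, fun c hc => ?_⟩
    · rw [← h2, List.sum_cons, List.sum_cons]; abel
    · rcases List.mem_cons.mp hc with rfl | hc
      · simpa using h3 b (by simp)
      · exact h3 c (by simp [hc])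

section Hub

variable {n : ℕ}

instance : Finite (HubVertex n) :=
  Finite.of_surjective (fun x : Unit ⊕ Fin n ⊕ Fin n =>
    match x with
    | .inl _ => HubVertex.w
    | .inr (.inl i) => HubVertex.u i
    | .inr (.inr i) => HubVertex.v i) fun v => by
      cases v with
      | w => exact ⟨.inl (), rfl⟩
      | u i => exact ⟨.inr (.inl i), rfl⟩
      | v i => exact ⟨.inr (.inr i), rfl⟩

instance : Nonempty (HubVertex n) := ⟨.w⟩

theorem incidentWeights_append {V : Type*} (σ τ : List (WEdge V)) (v : V) :
    incidentWeights (σ ++ τ) v = incidentWeights σ v ++ incidentWeights τ v := by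
  simp [incidentWeights]

open scoped Classical in
theorem coe_incidentWeights_flatMap {V : Type*} (v : V) (p : Fin n → Sym2 V) (B : List ℝ) :
    (incidentWeights ((List.finRange n).flatMap fun i => B.map fun x => (⟨p i, x⟩ : WEdge V)) v :
      Multiset ℝ) = ∑ i, if v ∈ p i then (B : Multiset ℝ) else 0 := by
  rw [← List.sum_ofFn, List.ofFn_eq_map]
  induction List.finRange n with
  | nil => simp [incidentWeights]
  | cons i l ih =>
    rw [List.flatMap_cons, incidentWeights_append, ← Multiset.coe_add, ih, List.map_cons,
      List.sum_cons]
    congr 1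
    by_cases h : v ∈ p i
    · simp [incidentWeights, h, List.filter_map, Function.comp_def]
    · simp [incidentWeights, h, List.filter_map, Function.comp_def]

theorem coe_incidentWeights_w (A B : List ℝ) :
    (incidentWeights (hubSequence A fun _ : Fin n => B) .w : Multiset ℝ) =
      n • (B : Multiset ℝ) := by
  rw [hubSequence, incidentWeights_append, ← Multiset.coe_add, coe_incidentWeights_flatMap,
    coe_incidentWeights_flatMap]
  simp

theorem coe_incidentWeights_u (A B : List ℝ) (i : Fin n) :
    (incidentWeights (hubSequence A fun _ : Fin n => B) (.u i) : Multiset ℝ) = A + B := by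
  rw [hubSequence, incidentWeights_append, ← Multiset.coe_add, coe_incidentWeights_flatMap,
    coe_incidentWeights_flatMap]
  simp

theorem coe_incidentWeights_v (A B : List ℝ) (i : Fin n) :
    (incidentWeights (hubSequence A fun _ : Fin n => B) (.v i) : Multiset ℝ) = A := by
  rw [hubSequence, incidentWeights_append, ← Multiset.coe_add, coe_incidentWeights_flatMap,
    coe_incidentWeights_flatMap]
  simp

theorem minBins_le_packingNumber {V : Type*} [Finite V] (σ : List (WEdge V)) (v : V) :
    minBins (incidentWeights σ v) ≤ packingNumber σ :=
  le_ciSup (f := fun v => minBins (incidentWeights σ v)) (Set.finite_range _).bddAbove v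

theorem numNeighbours_le_maxNeighbours {V : Type*} [Finite V] (σ : List (WEdge V)) (v : V) :
    numNeighbours σ v ≤ maxNeighbours σ :=
  le_ciSup (f := numNeighbours σ) (Set.finite_range _).bddAbove v

theorem validSequence_hubSequence {A B : List ℝ} (hA : UnitWeights A) (hB : UnitWeights B) :
    ValidSequence (hubSequence A fun _ : Fin n => B) := by
  intro e he
  simp only [hubSequence, List.mem_append, List.mem_flatMap, List.mem_map] at he
  rcases he with ⟨i, -, x, hx, rfl⟩ | ⟨i, -, x, hx, rfl⟩
  · exact ⟨by simp, hA x hx⟩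
  · exact ⟨by simp, hB x hx⟩

theorem weight_le_one_of_mem_incidentWeights {V : Type*} {σ : List (WEdge V)}
    (hσ : ValidSequence σ) (v : V) : ∀ x ∈ incidentWeights σ v, x ≤ 1 := by
  intro x hx
  obtain ⟨e, he, rfl⟩ := List.mem_map.mp hx
  exact (hσ e (List.mem_of_mem_filter he)).2.2

theorem mem_hubSequence_ends {A B : List ℝ} {e : WEdge (HubVertex n)}
    (he : e ∈ hubSequence A fun _ : Fin n => B) :
    (∃ i, e.ends = s(.u i, .v i)) ∨ ∃ i, e.ends = s(.w, .u i) := by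
  simp only [hubSequence, List.mem_append, List.mem_flatMap, List.mem_map] at he
  rcases he with ⟨i, -, x, hx, rfl⟩ | ⟨i, -, x, hx, rfl⟩
  exacts [Or.inl ⟨i, rfl⟩, Or.inr ⟨i, rfl⟩]

theorem numNeighbours_w {A B : List ℝ} (hB : B ≠ []) :
    numNeighbours (hubSequence A fun _ : Fin n => B) .w = n := by
  have : {x : HubVertex n | x ≠ .w ∧ ∃ e ∈ hubSequence A fun _ : Fin n => B,
      e.ends = s(HubVertex.w, x)} = Set.range HubVertex.u := by
    ext x
    constructor
    · rintro ⟨-, e, he, hx⟩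
      rcases mem_hubSequence_ends he with ⟨i, hi⟩ | ⟨i, hi⟩
      · rw [hi] at hx; simp at hx
      · rw [hi] at hx
        exact ⟨i, by simpa using hx⟩
    · rintro ⟨i, rfl⟩
      obtain ⟨b, hb⟩ := List.exists_mem_of_ne_nil B hB
      refine ⟨by simp, ⟨s(.w, .u i), b⟩, ?_, rfl⟩
      simp [hubSequence, hb]
  have hinj : Function.Injective (HubVertex.u : Fin n → HubVertex n) := fun i j h => by
    simpa using h
  rw [numNeighbours, this, Set.ncard_def, ← Set.image_univ, hinj.encard_image]
  simp

theorem maxNeighbours_hubSequence_le {A B : List ℝ} (hn : 0 < n) (hB : B ≠ []) :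
    maxNeighbours (hubSequence A fun _ : Fin n => B) ≤ n + 1 := by
  refine ciSup_le fun v => ?_
  cases v with
  | w => rw [numNeighbours_w hB]; exact Nat.le_succ n
  | u i =>
    refine le_trans (Set.ncard_le_ncard (t := {HubVertex.v i, HubVertex.w}) ?_ (Set.toFinite _))
      ((Set.ncard_insert_le _ _).trans (by simpa using Nat.succ_le_of_lt hn))
    rintro x ⟨-, e, he, hx⟩
    rcases mem_hubSequence_ends he with ⟨j, hj⟩ | ⟨j, hj⟩
    · rw [hj, Sym2.eq_iff] at hx
      rcases hx with ⟨h1, h2⟩ | ⟨h1, h2⟩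
      · rw [HubVertex.u.injEq] at h1; subst h1; simp [← h2]
      · simp at h2
    · rw [hj, Sym2.eq_iff] at hx
      rcases hx with ⟨h1, h2⟩ | ⟨h1, h2⟩
      · simp at h1
      · simp [← h1]
  | v i =>
    refine le_trans (Set.ncard_le_ncard (t := {HubVertex.u i}) ?_ (Set.toFinite _))
      (by simp)
    rintro x ⟨-, e, he, hx⟩
    rcases mem_hubSequence_ends he with ⟨j, hj⟩ | ⟨j, hj⟩
    · rw [hj, Sym2.eq_iff] at hx
      rcases hx with ⟨h1, h2⟩ | ⟨h1, h2⟩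
      · simp at h1
      · rw [HubVertex.v.injEq] at h2; subst h2; simp [← h1]
    · rw [hj, Sym2.eq_iff] at hx
      rcases hx with ⟨h1, h2⟩ | ⟨h1, h2⟩
      · simp at h1
      · simp at h2

theorem unitWeights_append {L L' : List ℝ} (hL : UnitWeights L) (hL' : UnitWeights L') :
    UnitWeights (L ++ L') := by
  intro x hx
  rcases List.mem_append.mp hx with hx | hx
  exacts [hL x hx, hL' x hx]

/-- By adding items of size 1, the parameter of a hub sequence can be given any larger value. -/
theorem exists_packingNumber_eq (hn : 0 < n) {A B : List ℝ} (hA : UnitWeights A)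
    (hB : UnitWeights B) {m : ℕ} (hm : packingNumber (hubSequence A fun _ : Fin n => B) ≤ m) :
    ∃ k, packingNumber (hubSequence (A ++ List.replicate k 1) fun _ : Fin n => B) = m := by
  have hA' : ∀ k, UnitWeights (A ++ List.replicate k 1) := fun k =>
    unitWeights_append hA fun x hx => by rw [List.eq_of_mem_replicate hx]; norm_num
  have hvalid := fun k => validSequence_hubSequence (n := n) (hA' k) hB
  have hcoe : ∀ k, ((A ++ List.replicate (k + 1) 1 : List ℝ) : Multiset ℝ) =
      ((A ++ List.replicate k 1 : List ℝ) : Multiset ℝ) + ({1} : Multiset ℝ) := by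
    intro k
    rw [List.replicate_succ', ← List.append_assoc, ← Multiset.coe_add]
    rfl
  have hone : Packable ({1} : Multiset ℝ) 1 := ⟨[{1}], by simp⟩
  have hstep : ∀ k, packingNumber (hubSequence (A ++ List.replicate (k + 1) 1) fun _ : Fin n => B) ≤
      packingNumber (hubSequence (A ++ List.replicate k 1) fun _ : Fin n => B) + 1 := by
    intro k
    refine ciSup_le fun v => ?_
    refine le_trans (minBins_le_of_packable (k := minBins (incidentWeights
      (hubSequence (A ++ List.replicate k 1) fun _ : Fin n => B) v) + 1) ?_)
      (Nat.add_le_add_right (minBins_le_packingNumber _ v) 1)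
    have hp := packable_minBins (weight_le_one_of_mem_incidentWeights (hvalid k) v)
    cases v with
    | w =>
      rw [coe_incidentWeights_w] at hp ⊢
      exact hp.mono (Nat.le_succ _)
    | u i =>
      rw [coe_incidentWeights_u] at hp ⊢
      rw [hcoe, add_right_comm]
      exact hp.add hone
    | v i =>
      rw [coe_incidentWeights_v] at hp ⊢
      rw [hcoe]
      exact hp.add hone
  -- The vertex `v` sees exactly the padded list, whose total size is at least `k`.
  have hge : ∀ k, k ≤ packingNumber (hubSequence (A ++ List.replicate k 1) fun _ : Fin n => B) := by
    intro k
    refine le_trans ?_ (minBins_le_packingNumber _ (.v ⟨0, hn⟩))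
    have h1 := (packable_minBins (weight_le_one_of_mem_incidentWeights (hvalid k)
      (.v ⟨0, hn⟩))).sum_le
    rw [coe_incidentWeights_v, Multiset.sum_coe, List.sum_append, List.sum_replicate, nsmul_eq_mul,
      mul_one] at h1
    have h2 : 0 ≤ A.sum := List.sum_nonneg fun x hx => (hA x hx).1
    have : (k : ℝ) ≤ _ := le_trans (le_add_of_nonneg_left h2) h1
    exact_mod_cast this
  have hex : ∃ k, m ≤ packingNumber (hubSequence (A ++ List.replicate k 1) fun _ : Fin n => B) :=
    ⟨m, hge m⟩
  classical
  -- Discrete intermediate value argument: the parameter starts at most at `m`, grows by at most 1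
  -- per padding item, and eventually reaches `m`.
  refine ⟨Nat.find hex, le_antisymm ?_ (Nat.find_spec hex)⟩
  cases hk : Nat.find hex with
  | zero => simpa using hm
  | succ k =>
    have h1 := Nat.find_min hex (m := k) (by omega)
    have h2 := hstep k
    omega

end Hub

/-! ### Choice of the lists and tightness -/

/-- The hub sequences on which the coloring algorithm performs badly. -/
theorem exists_hubSequence {m : ℕ} (hm : 1 ≤ m) :
    ∃ A B : List ℝ,
      ValidSequence (hubSequence A fun _ : Fin (Nat.sqrt m) => B) ∧
      packingNumber (hubSequence A fun _ : Fin (Nat.sqrt m) => B) = m ∧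
      B ≠ [] ∧
      2 * harmonicRatio 12 * m ≤
        (harmonicBins 12 A + Nat.sqrt m * harmonicBins 12 B : ℕ) + 60 * Nat.sqrt m ∧
      ((harmonicBins 12 A + Nat.sqrt m * harmonicBins 12 B : ℕ) : ℝ) ≤
        2 * harmonicRatio 12 * m + 24 * Nat.sqrt m := by
  obtain ⟨hR1, hR2⟩ := harmonicRatio_twelve_mem
  set s := Nat.sqrt m with hs
  have hs0 : 0 < s := Nat.sqrt_pos.mpr hm
  have hss : s * s ≤ m := Nat.sqrt_le m
  have hsm : s ≤ m := Nat.sqrt_le_self m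
  have hms : m ≤ s * s + s + s := Nat.sqrt_le_add m
  -- The lists share the capacity `m` at `u i`, while the hub carries `s` copies of the second list,
  -- hence at most `s * s ≤ m` bins.
  obtain ⟨A₀, hA1, hA2, hA3⟩ := exists_list_harmonicRatio (m - s)
  obtain ⟨B₀, hB1, hB2, hB3⟩ := exists_list_harmonicRatio s
  -- The item of size 0 needs no extra bin but keeps the list nonempty, so the hub really has `s`
  -- neighbours.
  have hB : UnitWeights (B₀ ++ [0]) := unitWeights_append hB1 fun x hx => by
    rw [List.mem_singleton.mp hx]; norm_num
  have hBp : Packable (B₀ ++ [0] : List ℝ) s := by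
    rw [← Multiset.coe_add]
    exact ((packable_minBins fun x hx => (hB1 x hx).2).mono hB2).add_zero_item hs0
  have hAp : Packable A₀ (m - s) := (packable_minBins fun x hx => (hA1 x hx).2).mono hA2
  obtain ⟨k, hk⟩ := exists_packingNumber_eq hs0 hA1 hB (m := m) (by
    refine ciSup_le fun v => minBins_le_of_packable ?_
    cases v with
    | w => rw [coe_incidentWeights_w]; exact (hBp.nsmul s).mono hss
    | u i => rw [coe_incidentWeights_u]; exact (hAp.add hBp).mono (by omega)
    | v i => rw [coe_incidentWeights_v]; exact hAp.mono (by omega))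
  have hA : UnitWeights (A₀ ++ List.replicate k 1) :=
    unitWeights_append hA1 fun x hx => by rw [List.eq_of_mem_replicate hx]; norm_num
  have hvalid := validSequence_hubSequence (n := s) hA hB
  refine ⟨A₀ ++ List.replicate k 1, B₀ ++ [0], hvalid, hk, by simp, ?_, ?_⟩
  · have h1 : (harmonicBins 12 A₀ : ℝ) ≤ harmonicBins 12 (A₀ ++ List.replicate k 1) := by
      exact_mod_cast harmonicBins_le_append (by norm_num) _ _
    have h2 : (harmonicBins 12 B₀ : ℝ) ≤ harmonicBins 12 (B₀ ++ [0]) := by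
      exact_mod_cast harmonicBins_le_append (by norm_num) _ _
    rw [Nat.cast_sub hsm] at hA3
    have h3 := mul_le_mul_of_nonneg_left (hB3.trans (add_le_add_left h2 26))
      (Nat.cast_nonneg' (α := ℝ) s)
    have h4 : (m : ℝ) ≤ s * s + s + s := by exact_mod_cast hms
    have h5 := mul_le_mul_of_nonneg_left h4 (by linarith : 0 ≤ harmonicRatio 12)
    have h6 : (1 : ℝ) ≤ s := by exact_mod_cast hs0
    have h7 : harmonicRatio 12 * s ≤ 2 * s := mul_le_mul_of_nonneg_right (by linarith) (by linarith)
    push_cast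
    nlinarith
  · have h1 := harmonicBins_le_harmonicRatio hA
    have h2 := harmonicBins_le_harmonicRatio hB
    have h3 : (minBins (A₀ ++ List.replicate k 1) : ℝ) ≤ m := by
      have hp := packable_minBins (weight_le_one_of_mem_incidentWeights hvalid (.v ⟨0, hs0⟩))
      rw [coe_incidentWeights_v] at hp
      have := (minBins_le_of_packable hp).trans (minBins_le_packingNumber _ _)
      rw [hk] at this
      exact_mod_cast this
    have h4 : (minBins (B₀ ++ [0]) : ℝ) ≤ s := by exact_mod_cast minBins_le_of_packable hBp
    have hR0 : 0 ≤ harmonicRatio 12 := by linarith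
    have h5 := mul_le_mul_of_nonneg_left h3 hR0
    have h6 := mul_le_mul_of_nonneg_left h4 hR0
    have h7 := mul_le_mul_of_nonneg_left (h2.trans (add_le_add_left h6 12))
      (Nat.cast_nonneg' (α := ℝ) s)
    have h8 : (s : ℝ) * s ≤ m := by exact_mod_cast hss
    have h9 := mul_le_mul_of_nonneg_left h8 hR0
    have h10 : (1 : ℝ) ≤ s := by exact_mod_cast hs0
    push_cast
    nlinarith

theorem hub_sequences : ∃ C : ℝ, ∀ m : ℕ, 1 ≤ m → ∃ ε : ℕ, 0 < ε ∧ (ε : ℝ) ≤ C * √(m : ℝ) ∧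
    ∃ (A : List ℝ) (B : Fin (Nat.sqrt m) → List ℝ),
      ValidSequence (hubSequence A B) ∧
      packingNumber (hubSequence A B) = m ∧
      numNeighbours (hubSequence A B) HubVertex.w = Nat.sqrt m ∧
      maxNeighbours (hubSequence A B) ≤ Nat.sqrt m + 1 ∧
      2 * harmonicRatio 12 * m - ε ≤ ((usedColors 12 (hubSequence A B)).card : ℝ) ∧
      ((usedColors 12 (hubSequence A B)).card : ℝ) ≤ 2 * harmonicRatio 12 * m + ε ∧
      ∀ c ∈ usedColors 12 (hubSequence A B),
        (c : ℝ) ≤ 3.39 * m + 24 * maxNeighbours (hubSequence A B) := by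
  refine ⟨60, fun m hm => ?_⟩
  obtain ⟨A, B, h1, h2, h3, h4, h5⟩ := exists_hubSequence hm
  have hs0 : 0 < Nat.sqrt m := Nat.sqrt_pos.mpr hm
  have hs : (0 : ℝ) ≤ Nat.sqrt m := by positivity
  have hw := numNeighbours_w (n := Nat.sqrt m) (A := A) h3
  have hcolors := usedColors_hubSequence (M := 12) hs0 A B
  refine ⟨60 * Nat.sqrt m, by omega, ?_, A, fun _ => B, h1, h2, hw,
    maxNeighbours_hubSequence_le hs0 h3, ?_, ?_, ?_⟩
  · push_cast
    exact mul_le_mul_of_nonneg_left Real.nat_sqrt_le_real_sqrt (by norm_num)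
  · rw [hcolors, Nat.card_Icc, Nat.add_sub_cancel]
    push_cast at h4 ⊢
    linarith
  · rw [hcolors, Nat.card_Icc, Nat.add_sub_cancel]
    push_cast at h5 ⊢
    linarith
  · intro c hc
    rw [hcolors, Finset.mem_Icc] at hc
    have h6 : (c : ℝ) ≤ (harmonicBins 12 A + Nat.sqrt m * harmonicBins 12 B : ℕ) := by
      exact_mod_cast hc.2
    have h7 : (Nat.sqrt m : ℝ) ≤ maxNeighbours (hubSequence A fun _ : Fin (Nat.sqrt m) => B) := by
      have := numNeighbours_le_maxNeighbours (hubSequence A fun _ : Fin (Nat.sqrt m) => B) .w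
      rw [hw] at this
      exact_mod_cast this
    -- Twice the upper bound for the ratio is below 3.39, and the error `24 * Nat.sqrt m` is covered
    -- since the hub has `Nat.sqrt m` neighbours.
    have h8 := mul_le_mul_of_nonneg_right harmonicRatio_twelve_mem.2 (Nat.cast_nonneg' (α := ℝ) m)
    have h9 : (0 : ℝ) ≤ m := by positivity
    linarith

theorem two_mul_harmonicRatio_le {α β : ℝ}
    (h : ∀ (V : Type) [Finite V] (σ : List (WEdge V)), ValidSequence σ →
      ((usedColors 12 σ).card : ℝ) ≤ α * packingNumber σ + β * maxNeighbours σ) :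
    2 * harmonicRatio 12 ≤ α := by
  obtain ⟨C, hC⟩ := hub_sequences
  -- For `m = k * k` all errors, including the neighbour term, are linear in `k`. Division by `k`
  -- leaves a constant against terms that grow linearly.
  refine le_of_forall_nat_mul_le (c := |C| + 2 * |β|) fun k => ?_
  rcases Nat.eq_zero_or_pos k with rfl | hk
  · simp only [Nat.cast_zero, zero_mul, zero_add]
    positivity
  obtain ⟨ε, -, h1, A, B, h2, h3, -, h4, h5, -, -⟩ := hC (k * k) (Nat.mul_pos hk hk)
  have h6 := h _ _ h2
  rw [h3] at h6
  have hk1 : (1 : ℝ) ≤ k := by exact_mod_cast hk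
  push_cast at h1 h5 h6
  rw [Real.sqrt_mul_self (by linarith)] at h1
  have h7 : (maxNeighbours (hubSequence A B) : ℝ) ≤ k + 1 := by
    have := h4.trans_eq (congrArg (· + 1) (Nat.sqrt_eq k))
    exact_mod_cast this
  have h8 : β * maxNeighbours (hubSequence A B) ≤ |β| * (k + 1) :=
    (mul_le_mul_of_nonneg_right (le_abs_self β) (by positivity)).trans
      (mul_le_mul_of_nonneg_left h7 (abs_nonneg β))
  have h9 : C * k ≤ |C| * k := mul_le_mul_of_nonneg_right (le_abs_self C) (by linarith)
  have h10 : |β| * 1 ≤ |β| * k := mul_le_mul_of_nonneg_left hk1 (abs_nonneg β)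
  refine le_of_mul_le_mul_left ?_ (by linarith : (0 : ℝ) < k)
  linarith

theorem mainTheorem2 :
    -- the asymptotic performance ratio of HARMONIC with 12 types
    (1.6924 < harmonicRatio 12 ∧ harmonicRatio 12 < 1.6927) ∧
    -- the hub sequences
    (∃ C : ℝ, ∀ m : ℕ, 1 ≤ m → ∃ ε : ℕ, 0 < ε ∧ (ε : ℝ) ≤ C * √(m : ℝ) ∧
      ∃ (A : List ℝ) (B : Fin (Nat.sqrt m) → List ℝ),
        ValidSequence (hubSequence A B) ∧
        packingNumber (hubSequence A B) = m ∧
        numNeighbours (hubSequence A B) HubVertex.w = Nat.sqrt m ∧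
        maxNeighbours (hubSequence A B) ≤ Nat.sqrt m + 1 ∧
        2 * harmonicRatio 12 * m - ε ≤ ((usedColors 12 (hubSequence A B)).card : ℝ) ∧
        ((usedColors 12 (hubSequence A B)).card : ℝ) ≤ 2 * harmonicRatio 12 * m + ε ∧
        ∀ c ∈ usedColors 12 (hubSequence A B),
          (c : ℝ) ≤ 3.39 * m + 24 * maxNeighbours (hubSequence A B)) ∧
    -- hence the factor in front of `m` in the analysis cannot be improved
    (∀ α β : ℝ,
      (∀ (V : Type) [Finite V] (σ : List (WEdge V)), ValidSequence σ →
        ((usedColors 12 σ).card : ℝ) ≤ α * packingNumber σ + β * maxNeighbours σ) →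
      2 * harmonicRatio 12 ≤ α) := by
  obtain ⟨h1, h2⟩ := harmonicRatio_twelve_mem
  exact ⟨⟨lt_of_lt_of_le (by norm_num) h1, lt_of_le_of_lt h2 (by norm_num)⟩, hub_sequences,
    fun _ _ h => two_mul_harmonicRatio_le h⟩
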